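/- Let $\mathcal G$ be a connected, locally finite metric graph with countable vertex and edge sets; each edge $e$ has a length $l_e>0$ and is identified with an interval $[a_e,b_e]$ of length $l_e$, and $\mathcal G$ carries the geodesic distance. Let $\partial\mathcal G$ be a set of vertices (the boundary vertices) containing all vertices of degree $1$; the other vertices are called interior. Let $\overline{\mathcal G}$ be the metric completion of $\mathcal G$ and $\partial\overline{\mathcal G}=\overline{\mathcal G}\setminus(\mathcal G\setminus\partial\mathcal G)$. Assume that $\overline{\mathcal G}$ is compact and that $\partial\overline{\mathcal G}$ is totally disconnected. Write $L^2(\mathcal G)=\bigoplus_e L^2[a_e,b_e]$ (real-valued functions), $\langle f,g\rangle_2=\int_{\mathcal G}fg$, and $N_\epsilon(A)$ for the open $\epsilon$-neighborhood of $A$ in $\overline{\mathcal G}$. Let $\mathcal D_{max}$ be the set of continuous $f:\mathcal G\to\mathbb R$ whose restriction to each closed edge is differentiable with absolutely continuous derivative, with $f,f''\in L^2(\mathcal G)$, and with $\sum_{e\sim v}\partial_\nu f_e(v)=0$ at each interior vertex $v$, where $\partial_\nu f_e(v)$ is the derivative at $v$ in the direction from $v$ into $e$. A function is harmonic in an open set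 $U\subset\overline{\mathcal G}$ if it is continuous on $U$, has vanishing second derivative on the parts of open edges in $U$, and satisfies this vertex condition at the interior vertices in $U$; it has finite energy in $U$ if its derivative is square integrable over $U\cap\mathcal G$. Let $E_0,E_1,\dots,E_N$ be a partition of $\partial\overline{\mathcal G}$ by (relatively) clopen sets, with $E_1,\dots,E_N$ nonempty ($E_0$ may be empty), and let $\delta>0$ be such that the sets $N_\delta(E_n)$ are pairwise disjoint and $N_\delta(E_n)$ has finite volume (Lebesgue measure) for $n=1,\dots,N$. Let $\mathcal E(0)=\{E_0,\dots,E_N\}$, and for each $j\ge 0$ let $\mathcal E(j+1)$ arise from $\mathcal E(j)$ by splitting every set of $\mathcal E(j)$ into two nonempty disjoint clopen sets, or keeping it if it cannot be so split. Given functions $\mathcal H=\{h_n : n=1,\dots,N\}$, with $h_n$ defined on $N_\delta(E_n)$, let $\mathcal D_{\mathcal E(j),\mathcal H(j)}$ be the set of $\phi\in\mathcal D_{max}$ such that, for some $\epsilon\in(0,\delta)$, $\phi=0$ on $N_\epsilon(A)\cap\mathcal G$ for each $A\in\mathcal E(j)$ with $A\subset E_0$, and, for each $A\in\mathcal E(j)$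 with $A\subset E_n$, $n\ge1$, there is a constant $c_A$ with $\phi=c_Ah_n$ on $N_\epsilon(A)\cap\mathcal G$. Let $S$ act by $-D^2$ on this domain, and set $\langle f,g\rangle_F=\langle Sf,g\rangle_2+\langle f,g\rangle_2$. The completion of the domain with respect to $\langle\cdot,\cdot\rangle_F$ is the set of $f\in L^2(\mathcal G)$ that are $L^2$-limits of sequences $(f_i)$ in the domain which are Cauchy for $\langle\cdot,\cdot\rangle_F$; the closed form $\tau$ on it is given by $\tau[f,f]=\lim_i\langle Sf_i,f_i\rangle_2$. (a) Suppose that $\mathcal K=\{k_n : n=1,\dots,N\}$, where each $k_n$ is harmonic with finite energy in $N_\delta(E_n)$, has a constant value $C_n>0$ on $E_n$, and satisfies $\partial_\nu k_n>0$ on the level sets $\{k_n=t\}$ near $E_n$ for all $t\neq C_n$ sufficiently close to $C_n$. The last condition means: there is $\eta>0$ such that, whenever $0<|t-C_n|<\eta$ and $x\in N_\eta(E_n)$ is an interior point of an edge with $k_n(x)=t$, the derivative of $k_n$ at $x$ along the edge is positive in each direction pointing away from $E_n$, that is, each direction such that the part of the edge just behind $x$ lies in a connected subset of $N_\eta(E_n)\setminus\{k_n=t\}$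 that meets $E_n$. Then, for every $j$, every $f$ in the completion of $\mathcal D_{\mathcal E(j),\mathcal K(j)}$ with respect to $\langle\cdot,\cdot\rangle_F$ has a representative which is continuous on $\overline{\mathcal G}$ and absolutely continuous on the edges of $\mathcal G$, with $f'\in L^2(\mathcal G)$. (b) Suppose instead that the functions $h_n$, $n=1,\dots,N$, are constants. Then, for every $j$, every $f$ in the completion of $\mathcal D_{\mathcal E(j),\mathcal H(j)}$ has such a representative, and $\tau[f,f]=\int_{\mathcal G}(f')^2$ (the value of the limit defining $\tau[f,f]$ being the same for all admissible sequences along which it exists). -/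

import Mathlib

open Set Filter Topology MeasureTheory

noncomputable section

/-- A connected, locally finite metric graph with vertex set `V` and edge set `Edge`, together with
its set `bdry` of boundary vertices. The edge `e` has length `len e`, runs from `src e` to `tgt e`
and is identified with the interval `[0, len e]`. Loops and multiple edges are allowed; a loop is
incident twice on its vertex. -/
structure MetricGraph (V Edge : Type*) where
  src : Edge → V
  tgt : Edge → V
  len : Edge → ℝ
  len_pos : ∀ e, 0 < len e
  finite_incident : ∀ v, {e | src e = v ∨ tgt e = v}.Finite
  connected : ∀ v w, Relation.EqvGen (fun a b => ∃ e, src e = a ∧ tgt e = b) v w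
  bdry : Set V
  /-- every vertex of degree one is a boundary vertex -/
  mem_bdry_of_degree_one :
    ∀ v, {e | src e = v}.ncard + {e | tgt e = v}.ncard = 1 → v ∈ bdry

namespace MetricGraph

variable {V Edge : Type*} (G : MetricGraph V Edge)

/-- Representatives of the points of the metric graph: vertices, and points of closed edges.
An endpoint of an edge and the corresponding vertex represent the same point; they are at distance
`0` in the geodesic pseudometric below, so they are identified in the metric completion. -/
def Point : Type _ := V ⊕ (Σ e : Edge, Icc (0 : ℝ) (G.len e))

/-- A vertex, as a point. -/
def vertex (v : V) : G.Point := Sum.inl v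

/-- The point with coordinate `s` on the edge `e` (`s` is clamped to `[0, len e]`). -/
def onEdge (e : Edge) (s : ℝ) : G.Point :=
  Sum.inr ⟨e, projIcc 0 (G.len e) (G.len_pos e).le s⟩

/-- `G.Step x y c`: one can go from `x` to `y` inside a closed edge, over a distance `c`. -/
inductive Step : G.Point → G.Point → ℝ → Prop
  | along (e : Edge) (s t : Icc (0 : ℝ) (G.len e)) :
      Step (Sum.inr ⟨e, s⟩) (Sum.inr ⟨e, t⟩) |(t : ℝ) - s|
  | leaveSrc (e : Edge) : Step (G.vertex (G.src e)) (G.onEdge e 0) 0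
  | enterSrc (e : Edge) : Step (G.onEdge e 0) (G.vertex (G.src e)) 0
  | leaveTgt (e : Edge) : Step (G.vertex (G.tgt e)) (G.onEdge e (G.len e)) 0
  | enterTgt (e : Edge) : Step (G.onEdge e (G.len e)) (G.vertex (G.tgt e)) 0

/-- `G.Path x y L`: there is a path of length `L` from `x` to `y`. -/
inductive Path : G.Point → G.Point → ℝ → Prop
  | refl (x : G.Point) : Path x x 0
  | tail {x y z : G.Point} {L c : ℝ} : Path x y L → G.Step y z c → Path x z (L + c)

variable {G}

lemma Step.symm {x y : G.Point} {c : ℝ} (h : G.Step x y c) : G.Step y x c := by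
  cases h with
  | along e s t => rw [abs_sub_comm]; exact Step.along e t s
  | leaveSrc e => exact Step.enterSrc e
  | enterSrc e => exact Step.leaveSrc e
  | leaveTgt e => exact Step.enterTgt e
  | enterTgt e => exact Step.leaveTgt e

lemma Step.nonneg {x y : G.Point} {c : ℝ} (h : G.Step x y c) : 0 ≤ c := by
  cases h <;> first | exact abs_nonneg _ | exact le_rfl

lemma Path.nonneg {x y : G.Point} {L : ℝ} (h : G.Path x y L) : 0 ≤ L := by
  induction h with
  | refl => exact le_rfl
  | tail _ s ih => exact add_nonneg ih s.nonneg

lemma Path.trans {x y z : G.Point} {L M : ℝ} (h : G.Path x y L) (k : G.Path y z M) :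
    G.Path x z (L + M) := by
  induction k with
  | refl => simpa using h
  | tail _ s ih => rw [← add_assoc]; exact ih.tail s

lemma Path.symm {x y : G.Point} {L : ℝ} (h : G.Path x y L) : G.Path y x L := by
  induction h with
  | refl => exact Path.refl _
  | tail _ s ih =>
    have := ((Path.refl _).tail s.symm).trans ih
    rwa [zero_add, add_comm] at this

lemma exists_path_of_edge (e : Edge) : ∃ L, G.Path (G.vertex (G.src e)) (G.vertex (G.tgt e)) L :=
  ⟨_, (((Path.refl _).tail (Step.leaveSrc e)).tail (Step.along e _ _)).tail (Step.enterTgt e)⟩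

lemma exists_path_vertex (v w : V) : ∃ L, G.Path (G.vertex v) (G.vertex w) L := by
  induction G.connected v w with
  | rel a b h => obtain ⟨e, rfl, rfl⟩ := h; exact exists_path_of_edge e
  | refl a => exact ⟨0, Path.refl _⟩
  | symm a b _ ih => obtain ⟨L, h⟩ := ih; exact ⟨L, h.symm⟩
  | trans a b c _ _ ih₁ ih₂ =>
    obtain ⟨L, h⟩ := ih₁
    obtain ⟨M, k⟩ := ih₂
    exact ⟨_, h.trans k⟩

lemma exists_path_to_vertex (x : G.Point) : ∃ v L, G.Path x (G.vertex v) L := by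
  rcases x with v | ⟨e, s⟩
  · exact ⟨v, 0, Path.refl _⟩
  · exact ⟨G.src e, _, ((Path.refl _).tail (Step.along e s _)).tail (Step.enterSrc e)⟩

lemma exists_path (x y : G.Point) : ∃ L, G.Path x y L := by
  obtain ⟨v, L, h⟩ := exists_path_to_vertex x
  obtain ⟨w, M, k⟩ := exists_path_to_vertex y
  obtain ⟨R, r⟩ := exists_path_vertex (G := G) v w
  exact ⟨_, (h.trans r).trans k.symm⟩

lemma bddBelow_path (x y : G.Point) : BddBelow {L | G.Path x y L} := ⟨0, fun _ h => h.nonneg⟩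

variable (G)

/-- The geodesic distance: the infimum of the lengths of the paths joining two points. -/
instance : PseudoMetricSpace G.Point where
  dist x y := sInf {L | G.Path x y L}
  dist_self x := le_antisymm (csInf_le (bddBelow_path x x) (Path.refl x))
    (le_csInf (exists_path x x) fun _ h => h.nonneg)
  dist_comm x y := by
    congr 1
    ext L
    exact ⟨Path.symm, Path.symm⟩
  dist_triangle x y z := by
    refine le_of_forall_pos_le_add fun ε hε => ?_
    obtain ⟨L, hL, hL'⟩ :=
      exists_lt_of_csInf_lt (exists_path x y) (lt_add_of_pos_right _ (half_pos hε))
    obtain ⟨M, hM, hM'⟩ :=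
      exists_lt_of_csInf_lt (exists_path y z) (lt_add_of_pos_right _ (half_pos hε))
    exact (csInf_le (bddBelow_path x z) (Path.trans hL hM)).trans
      ((add_le_add hL'.le hM'.le).trans_eq (by rw [add_add_add_comm, add_halves]; rfl))

/-- The metric completion of the metric graph. -/
abbrev Completion : Type _ := UniformSpace.Completion G.Point

/-- The interior of the graph: the points of the graph which are not boundary vertices. -/
def interior : Set G.Completion :=
  range ((↑) : G.Point → G.Completion) \ {x | ∃ v ∈ G.bdry, x = (G.vertex v : G.Completion)}

/-- The boundary of the completion: the complement of the interior of the graph. -/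
def boundary : Set G.Completion := G.interiorᶜ

/-! ### Functions on the graph, in edge coordinates -/

/-- Edge coordinates: `⟨e, s⟩` stands for the point with coordinate `s` of the edge `e`. -/
abbrev Coord (Edge : Type*) : Type _ := Σ _ : Edge, ℝ

/-- Lebesgue measure on the graph, in edge coordinates. -/
def vol : Measure (Coord Edge) :=
  Measure.sum fun e => (volume.restrict (Icc 0 (G.len e))).map (Sigma.mk e)

/-- The real Hilbert space `L²(𝒢) = ⊕ₑ L²[0, len e]`. -/
abbrev L2 : Type _ := Lp ℝ 2 G.vol

/-- The component of `f` on the edge `e`. -/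
def comp (f : G.Point → ℝ) (e : Edge) (s : ℝ) : ℝ := f (G.onEdge e s)

/-- The function `f` in edge coordinates. -/
def coord (f : G.Point → ℝ) (p : Coord Edge) : ℝ := G.comp f p.1 p.2

/-- The derivative on the closed edge `e` (one-sided at the endpoints). -/
def compDeriv (f : G.Point → ℝ) (e : Edge) : ℝ → ℝ :=
  derivWithin (G.comp f e) (Icc 0 (G.len e))

/-- The derivative `f'`, in edge coordinates. -/
def deriv₁ (f : G.Point → ℝ) (p : Coord Edge) : ℝ := G.compDeriv f p.1 p.2

/-- The second derivative `f''`, in edge coordinates. -/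
def deriv₂ (f : G.Point → ℝ) (p : Coord Edge) : ℝ :=
  derivWithin (G.compDeriv f p.1) (Icc 0 (G.len p.1)) p.2

/-- The condition `∑_{e ∼ v} ∂_ν f_e(v) = 0`, with derivatives in the direction pointing from `v`
into the edge. -/
def Kirchhoff (f : G.Point → ℝ) (v : V) : Prop :=
  (∑ᶠ (e : Edge) (_ : G.src e = v), G.compDeriv f e 0)
    + (∑ᶠ (e : Edge) (_ : G.tgt e = v), -G.compDeriv f e (G.len e)) = 0

/-- The maximal domain `𝒟_max` of `-D²`. -/
structure MemDmax (f : G.Point → ℝ) : Prop where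
  continuous : Continuous f
  differentiableOn : ∀ e, DifferentiableOn ℝ (G.comp f e) (Icc 0 (G.len e))
  absolutelyContinuous_deriv :
    ∀ e, AbsolutelyContinuousOnInterval (G.compDeriv f e) 0 (G.len e)
  memLp : MemLp (G.coord f) 2 G.vol
  memLp_deriv₂ : MemLp (G.deriv₂ f) 2 G.vol
  kirchhoff : ∀ v ∉ G.bdry, G.Kirchhoff f v

/-! ### Harmonic functions near the boundary -/

/-- The restriction to the graph of a function on the completion. -/
def res (F : G.Completion → ℝ) (x : G.Point) : ℝ := F (x : G.Completion)

/-- The edge coordinates of the points of the graph that lie in `U`. -/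
def coordSet (U : Set G.Completion) : Set (Coord Edge) :=
  {p | ((G.onEdge p.1 p.2 : G.Point) : G.Completion) ∈ U}

/-- `k` is harmonic in the open subset `U` of the completion: it is continuous there, satisfies
`D²k = 0` (is locally affine) on the open edges, and satisfies the vertex condition at the interior
vertices. -/
structure HarmonicOn (k : G.Completion → ℝ) (U : Set G.Completion) : Prop where
  continuousOn : ContinuousOn k U
  locally_affine : ∀ e, ∀ s ∈ Ioo 0 (G.len e), (⟨e, s⟩ : Coord Edge) ∈ G.coordSet U →
    ∃ m : ℝ, ∀ᶠ r in 𝓝 s, G.comp (G.res k) e r = G.comp (G.res k) e s + m * (r - s)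
  kirchhoff : ∀ v ∉ G.bdry, (G.vertex v : G.Completion) ∈ U → G.Kirchhoff (G.res k) v

/-- `k` has finite energy in `U`. -/
def FiniteEnergyOn (k : G.Completion → ℝ) (U : Set G.Completion) : Prop :=
  MemLp (G.deriv₁ (G.res k)) 2 (G.vol.restrict (G.coordSet U))

/-- At the point `x` with coordinate `s` of the open edge `e`, the direction `σ = ±1` of the edge
points away from `A`, relative to the level set of `k` through `x`: just behind `x` the edge runs
in the part of `N_η(A)` which is connected to `A` without meeting the level set. -/
def PointsAwayFrom (A : Set G.Completion) (η : ℝ) (k : G.Completion → ℝ) (e : Edge) (s σ : ℝ) :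
    Prop :=
  ∃ P ⊆ Metric.thickening η A ∩ {y | k y ≠ G.comp (G.res k) e s},
    IsPreconnected P ∧ (P ∩ A).Nonempty ∧
      ∃ r > 0, ∀ v ∈ Ioo 0 r, ((G.onEdge e (s - σ * v) : G.Point) : G.Completion) ∈ P

/-- `∂_ν k > 0` on the level sets `{k = t}` near `A`, for all `t ≠ C` sufficiently close to `C`:
there the derivative of `k` along an edge, in the direction pointing away from `A`, is positive. -/
def OutwardPositive (A : Set G.Completion) (C : ℝ) (k : G.Completion → ℝ) : Prop :=
  ∃ η > 0, ∀ t, t ≠ C → |t - C| < η →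
    ∀ e, ∀ s ∈ Ioo 0 (G.len e), G.comp (G.res k) e s = t →
      (⟨e, s⟩ : Coord Edge) ∈ G.coordSet (Metric.thickening η A) →
      ∀ σ : ℝ, σ = 1 ∨ σ = -1 → G.PointsAwayFrom A η k e s σ →
        0 < σ * deriv (G.comp (G.res k) e) s

/-! ### Partitions of the boundary -/

/-- `A` is a clopen subset of the boundary of the completion. -/
def IsBoundaryClopen (A : Set G.Completion) : Prop :=
  A ⊆ G.boundary ∧ IsClopen ((↑) ⁻¹' A : Set G.boundary)

/-- The initial partition `E 0, …, E N` of the boundary by clopen sets, whose `δ`-neighborhoods are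
disjoint and, for the indices `1, …, N`, have finite volume. The set `E 0` may be empty, that is,
absent from the partition. -/
structure IsInitialPartition {N : ℕ} (E : Fin (N + 1) → Set G.Completion) (δ : ℝ) : Prop where
  clopen : ∀ n, G.IsBoundaryClopen (E n)
  nonempty : ∀ n : Fin N, (E n.succ).Nonempty
  pairwise_disjoint : Pairwise fun m n => Disjoint (E m) (E n)
  iUnion_eq : ⋃ n, E n = G.boundary
  pos : 0 < δ
  thickening_disjoint :
    Pairwise fun m n => Disjoint (Metric.thickening δ (E m)) (Metric.thickening δ (E n))
  finite_volume : ∀ n : Fin N, G.vol (G.coordSet (Metric.thickening δ (E n.succ))) < ⊤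

/-- `A` is partitioned into the two nonempty clopen sets `A₁` and `A₂`. -/
def IsSplitting (A A₁ A₂ : Set G.Completion) : Prop :=
  G.IsBoundaryClopen A₁ ∧ G.IsBoundaryClopen A₂ ∧ A₁.Nonempty ∧ A₂.Nonempty ∧
    Disjoint A₁ A₂ ∧ A₁ ∪ A₂ = A

/-- A partition is a set of pairs `(A, n)`, where the label `n` says that `A` is contained in
`E n`. In the next partition every `A` is replaced by the two parts of a splitting of `A`, with
the same label, or kept if it has no splitting. -/
def IsNextPartition {N : ℕ} (P P' : Set (Set G.Completion × Fin (N + 1))) : Prop :=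
  ∃ parts : Set G.Completion × Fin (N + 1) → Set (Set G.Completion × Fin (N + 1)),
    (∀ p ∈ P,
      (∃ A₁ A₂, G.IsSplitting p.1 A₁ A₂ ∧ parts p = {(A₁, p.2), (A₂, p.2)}) ∨
      ((¬ ∃ A₁ A₂, G.IsSplitting p.1 A₁ A₂) ∧ parts p = {p})) ∧
    P' = ⋃ p ∈ P, parts p

/-- `G.IsPartitionSequence E 𝓔`: the sequence `𝓔 0, 𝓔 1, …` of labelled partitions starts with
`{E 0, …, E N}`, and every partition is obtained from the preceding one by splitting its sets. -/
def IsPartitionSequence {N : ℕ} (E : Fin (N + 1) → Set G.Completion)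
    (𝓔 : ℕ → Set (Set G.Completion × Fin (N + 1))) : Prop :=
  𝓔 0 = range (fun n => (E n, n)) ∧ ∀ j, G.IsNextPartition (𝓔 j) (𝓔 (j + 1))

/-- The domain `𝒟_{𝓔, 𝓗}`: the functions in `𝒟_max` which, in some `ε`-neighborhood of each set `A`
of the partition, vanish (label `0`) or are a constant multiple of the function `h n` assigned
to `A` (label `n + 1`). -/
def domain {N : ℕ} (P : Set (Set G.Completion × Fin (N + 1))) (δ : ℝ)
    (h : Fin N → G.Completion → ℝ) : Set (G.Point → ℝ) :=
  {φ | G.MemDmax φ ∧ ∃ ε, 0 < ε ∧ ε < δ ∧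
    (∀ A, (A, 0) ∈ P →
      ∀ x : G.Point, (x : G.Completion) ∈ Metric.thickening ε A → φ x = 0) ∧
    (∀ (n : Fin N) (A : Set G.Completion), (A, n.succ) ∈ P → ∃ c : ℝ,
      ∀ x : G.Point, (x : G.Completion) ∈ Metric.thickening ε A → φ x = c * h n x)}

/-- The conditions on the harmonic functions `k n`: harmonic with finite energy in the
`δ`-neighborhood of `E n`, with a constant value `C n > 0` on `E n`, and with positive outward
derivative on the level sets near `E n`. -/
structure IsPositiveFamily {N : ℕ} (E : Fin (N + 1) → Set G.Completion) (δ : ℝ)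
    (C : Fin N → ℝ) (k : Fin N → G.Completion → ℝ) : Prop where
  harmonic : ∀ n, G.HarmonicOn (k n) (Metric.thickening δ (E n.succ))
  finiteEnergy : ∀ n, G.FiniteEnergyOn (k n) (Metric.thickening δ (E n.succ))
  pos : ∀ n, 0 < C n
  eq_const : ∀ n, ∀ x ∈ E n.succ, k n x = C n
  outwardPositive : ∀ n, G.OutwardPositive (E n.succ) (C n) (k n)

/-! ### The form of `-D²` and its closure -/

/-- The form `⟨S f, g⟩₂`, where `S` acts by `-D²`. -/
def form (f g : G.Point → ℝ) : ℝ := ∫ p, -G.deriv₂ f p * G.coord g p ∂G.vol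

/-- The inner product `⟨f, g⟩_F = ⟨S f, g⟩₂ + ⟨f, g⟩₂`. -/
def innerF (f g : G.Point → ℝ) : ℝ := G.form f g + ∫ p, G.coord f p * G.coord g p ∂G.vol

/-- `u` is a Cauchy sequence in `D` for the inner product `⟨·,·⟩_F`, with limit `f` in `L²(𝒢)`. -/
structure FormConverges (D : Set (G.Point → ℝ)) (u : ℕ → G.Point → ℝ) (f : G.L2) : Prop where
  mem : ∀ n, u n ∈ D
  cauchy : Tendsto (fun p : ℕ × ℕ => G.innerF (u p.1 - u p.2) (u p.1 - u p.2)) atTop (𝓝 0)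
  tendsto : Tendsto (fun n => eLpNorm (G.coord (u n) - ⇑f) 2 G.vol) atTop (𝓝 0)

/-- The completion of `D` with respect to `⟨·,·⟩_F`, as a set of elements of `L²(𝒢)`: the domain of
the closed form `τ`. -/
def formCompletion (D : Set (G.Point → ℝ)) : Set G.L2 := {f | ∃ u, G.FormConverges D u f}

/-- `τ[f, f] = r` for the closed form `τ` extending the form of `S` with domain `D`. -/
def IsClosedFormValue (D : Set (G.Point → ℝ)) (f : G.L2) (r : ℝ) : Prop :=
  ∃ u, G.FormConverges D u f ∧ Tendsto (fun n => G.form (u n) (u n)) atTop (𝓝 r)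

/-- The element `f` of `L²(𝒢)` is represented by the function `F`, which is continuous on the
completion and absolutely continuous on the edges, with `F' ∈ L²(𝒢)`. -/
structure IsRegularRepresentative (f : G.L2) (F : G.Completion → ℝ) : Prop where
  ae_eq : f =ᵐ[G.vol] G.coord (G.res F)
  continuous : Continuous F
  absolutelyContinuous :
    ∀ e, AbsolutelyContinuousOnInterval (G.comp (G.res F) e) 0 (G.len e)
  memLp_deriv : MemLp (G.deriv₁ (G.res F)) 2 G.vol

end MetricGraph

end

noncomputable section

namespace MetricGraph

variable {V Edge : Type*} {G : MetricGraph V Edge}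

/-! ### The geodesic distance -/

/-! Everything follows from the energy inequality `∫ (φ')² ≤ ⟨Sφ, φ⟩₂` for `φ` in the domain, which
is an equality in case (b). The domain is a linear space of differences, so a form-Cauchy sequence
then has derivatives that are Cauchy in `L²`. A function of finite energy satisfies `|f x - f y| ≤
‖f'‖₂ √(dist x y)` (`abs_sub_le_eLpNorm_mul_sqrt`). Since the completion has finite diameter, the
sequence converges pointwise, its limit is uniformly continuous and extends to the completion, and
on each edge the limit is a primitive of the `L²`-limit of the derivatives
(`exists_isRegularRepresentative`). In case (b) the value of the closed form is the limit of the
energies.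

The energy inequality is an integration by parts without boundary terms. Compactness leaves only
finitely many edges outside a neighborhood of the boundary, so a test function vanishing near the
boundary sees a finite sum whose vertex terms cancel by the Kirchhoff condition
(`integral_neg_deriv₂_mul`). Near the boundary `φ = c (κ + b)` with `κ = k_n - C_n` and `b = C_n >
0`, hence `φ'' = 0` there. A cutoff `w` that is `1` away from the boundary can therefore be inserted
for free: `⟨Sφ, φ⟩₂ = ∫ φ' (φ w)' = ∫ (φ')² w + ∫ φ φ' w'`. The cutoff is built from `κ / t` and a
Lipschitz bump `θ`. As `φ φ' = c² (κ + b) κ'` and `κ ≥ 0`, the part of `w'` coming from `κ`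
contributes nonnegatively, and the part coming from `θ` costs at most a multiple of `|φ φ'|` on `{w
< 1}`. As `t → 0` this set shrinks to points with `κ = 0`; these minimize `κ`, so `φ' = 0` there,
and the error vanishes by dominated convergence (`HasBoundaryProfile.integral_sq_le_form`). In case
(b) one takes `κ = 0`: then `φ' = 0` wherever `w ≠ 1`, and nothing is lost.

The remaining input is `k_n ≥ C_n` near `E_n` (`OutwardPositive.exists_le`). If `k_n` dropped below
some `t < C_n`, a short path from near `E_n` would have a first crossing of `{k_n = t}`, going down
in a direction that points away from `E_n`, against the positivity of the outward derivative. -/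

lemma dist_le_of_path {x y : G.Point} {L : ℝ} (h : G.Path x y L) : dist x y ≤ L :=
  csInf_le (bddBelow_path x y) h

lemma exists_path_lt {x y : G.Point} {r : ℝ} (h : dist x y < r) : ∃ L < r, G.Path x y L := by
  obtain ⟨L, hL, hr⟩ := exists_lt_of_csInf_lt (exists_path x y) h
  exact ⟨L, hr, hL⟩

lemma dist_le_of_step {x y : G.Point} {c : ℝ} (h : G.Step x y c) : dist x y ≤ c := by
  simpa using dist_le_of_path ((Path.refl x).tail h)

lemma lipschitzWith_onEdge (e : Edge) : LipschitzWith 1 (G.onEdge e) := by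
  refine LipschitzWith.of_dist_le_mul fun s t => ?_
  refine (dist_le_of_step (Step.along e _ _)).trans ?_
  rw [abs_sub_comm, NNReal.coe_one, one_mul]
  have := (LipschitzWith.projIcc (G.len_pos e).le).dist_le_mul s t
  simpa [Subtype.dist_eq, Real.dist_eq] using this

lemma continuous_onEdge (e : Edge) : Continuous (G.onEdge e) := (lipschitzWith_onEdge e).continuous

lemma continuous_coe_onEdge (e : Edge) :
    Continuous fun s => ((G.onEdge e s : G.Point) : G.Completion) :=
  (UniformSpace.Completion.continuous_coe _).comp (continuous_onEdge e)

lemma onEdge_coe (e : Edge) (s : Icc (0 : ℝ) (G.len e)) : G.onEdge e s = Sum.inr ⟨e, s⟩ := by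
  rw [onEdge, projIcc_val]

lemma coe_eq_coe_of_step {x y : G.Point} (h : G.Step x y 0) :
    (x : G.Completion) = (y : G.Completion) :=
  dist_le_zero.1 <| by simpa using dist_le_of_step h

lemma coe_onEdge_zero (e : Edge) :
    ((G.onEdge e 0 : G.Point) : G.Completion) = (G.vertex (G.src e) : G.Completion) :=
  coe_eq_coe_of_step (Step.enterSrc e)

lemma coe_onEdge_len (e : Edge) :
    ((G.onEdge e (G.len e) : G.Point) : G.Completion) = (G.vertex (G.tgt e) : G.Completion) :=
  coe_eq_coe_of_step (Step.enterTgt e)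

/-- Points at pseudodistance zero are inseparable, so continuous functions cannot tell an edge
endpoint from its vertex. -/
lemma apply_eq_of_step {f : G.Point → ℝ} (hf : Continuous f) {x y : G.Point} (h : G.Step x y 0) :
    f x = f y :=
  (Metric.inseparable_iff.2 (le_antisymm (dist_le_of_step h) dist_nonneg)).map hf |>.eq

lemma comp_zero {f : G.Point → ℝ} (hf : Continuous f) (e : Edge) :
    G.comp f e 0 = f (G.vertex (G.src e)) := apply_eq_of_step hf (Step.enterSrc e)

lemma comp_len {f : G.Point → ℝ} (hf : Continuous f) (e : Edge) :
    G.comp f e (G.len e) = f (G.vertex (G.tgt e)) := apply_eq_of_step hf (Step.enterTgt e)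

lemma continuous_comp {f : G.Point → ℝ} (hf : Continuous f) (e : Edge) :
    Continuous (G.comp f e) := hf.comp (continuous_onEdge e)

/-- A function which varies by at most the length of every step is `1`-Lipschitz. -/
lemma abs_sub_le_dist_of_step {g : G.Point → ℝ}
    (hg : ∀ x y c, G.Step x y c → |g x - g y| ≤ c) (x y : G.Point) : |g x - g y| ≤ dist x y := by
  refine le_csInf (exists_path x y) fun L h => ?_
  induction h with
  | refl => simp
  | tail _ s ih => exact (abs_sub_le _ _ _).trans (add_le_add ih (hg _ _ _ s))

lemma exists_pos_le_len_of_finite {S : Set Edge} (hS : S.Finite) :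
    ∃ r > 0, ∀ e ∈ S, r ≤ G.len e := by
  have h : ∀ᶠ r : ℝ in 𝓝[>] 0, ∀ e ∈ S, r ≤ G.len e :=
    (eventually_all_finite hS).2 fun e _ =>
      nhdsWithin_le_nhds (eventually_le_nhds (G.len_pos e))
  obtain ⟨r, h, hr⟩ := (h.and self_mem_nhdsWithin).exists
  exact ⟨r, hr, h⟩

/-- The model is a truncated distance on an edge of length `l` whose endpoints carry the values `a`
and `b`; it is `1`-Lipschitz along the edge. -/
lemma abs_min_min_sub_le (r a b l s t : ℝ) :
    |min r (min (a + s) (b + (l - s))) - min r (min (a + t) (b + (l - t)))| ≤ |t - s| := by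
  refine (abs_min_sub_min_le_max _ _ _ _).trans (max_le (by simp) ?_)
  refine (abs_min_sub_min_le_max _ _ _ _).trans (max_le ?_ ?_)
  · rw [add_sub_add_left_eq_sub, abs_sub_comm]
  · rw [add_sub_add_left_eq_sub, sub_sub_sub_cancel_left]

/-- Take `r` below the lengths of all edges at `v`. The distance to `v` truncated at `r` is
dominated by the geodesic distance and equals `r` on every edge not incident with `v`, so the ball
of radius `r` meets only incident edges. -/
lemma exists_ball_vertex_finite (v : V) :
    ∃ r > 0, {e | ∃ s, dist (G.onEdge e s) (G.vertex v) < r}.Finite := by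
  classical
  obtain ⟨r, hr, hlen⟩ := exists_pos_le_len_of_finite (G := G) (G.finite_incident v)
  refine ⟨r, hr, (G.finite_incident v).subset ?_⟩
  rintro e ⟨s, hs⟩
  by_contra he
  -- Vertex values of the truncated distance. They agree with the edge values of `g` at the
  -- endpoints because no edge at `v` is shorter than `r`.
  let a : V → ℝ := fun w => if w = v then 0 else r
  have ha : ∀ w, 0 ≤ a w ∧ a w ≤ r := fun w => by
    by_cases h : w = v <;> simp [a, h, hr.le]
  let g : G.Point → ℝ := Sum.elim a fun p =>
    min r (min (a (G.src p.1) + p.2) (a (G.tgt p.1) + (G.len p.1 - p.2)))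
  have h0 : ∀ e, g (G.onEdge e 0) = a (G.src e) := fun e => by
    simp only [g, onEdge, Sum.elim_inr, projIcc_left]
    have h1 := ha (G.src e)
    have h2 := ha (G.tgt e)
    by_cases h : G.tgt e = v
    · have := hlen e (Or.inr h)
      grind
    · have : a (G.tgt e) = r := by simp [a, h]
      have := G.len_pos e
      grind
  have h1 : ∀ e, g (G.onEdge e (G.len e)) = a (G.tgt e) := fun e => by
    simp only [g, onEdge, Sum.elim_inr, projIcc_right]
    have h1 := ha (G.src e)
    have h2 := ha (G.tgt e)
    by_cases h : G.src e = v
    · have := hlen e (Or.inl h)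
      grind
    · have : a (G.src e) = r := by simp [a, h]
      have := G.len_pos e
      grind
  have hg : ∀ x y c, G.Step x y c → |g x - g y| ≤ c := by
    rintro x y c (⟨e, s, t⟩ | e | e | e | e)
    · exact abs_min_min_sub_le _ _ _ _ _ _
    · simp [h0, g, vertex]
    · simp [h0, g, vertex]
    · simp [h1, g, vertex]
    · simp [h1, g, vertex]
  have h := (abs_sub_le_dist_of_step hg (G.onEdge e s) (G.vertex v)).trans_lt hs
  simp only [mem_ofPred_eq, not_or] at he
  have e1 : a (G.src e) = r := by simp [a, he.1]
  have e2 : a (G.tgt e) = r := by simp [a, he.2]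
  have e3 : a v = 0 := by simp [a]
  simp only [g, onEdge, vertex, Sum.elim_inr, Sum.elim_inl, e1, e2, e3] at h
  have := (projIcc 0 (G.len e) (G.len_pos e).le s).2.1
  have := (projIcc 0 (G.len e) (G.len_pos e).le s).2.2
  grind

lemma exists_ball_finite (x : G.Point) :
    ∃ r > 0, {e | ∃ s, dist (G.onEdge e s) x < r}.Finite := by
  classical
  rcases x with v | ⟨e₀, s₀⟩
  · exact exists_ball_vertex_finite v
  have of_step : ∀ v, G.Step (Sum.inr ⟨e₀, s₀⟩) (G.vertex v) 0 →
      ∃ r > 0, {e | ∃ s, dist (G.onEdge e s) (Sum.inr ⟨e₀, s₀⟩ : G.Point) < r}.Finite := by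
    intro v hv
    obtain ⟨r, hr, h⟩ := exists_ball_vertex_finite (G := G) v
    refine ⟨r, hr, h.subset ?_⟩
    rintro e ⟨s, hs⟩
    exact ⟨s, (dist_triangle _ (show G.Point from Sum.inr ⟨e₀, s₀⟩) _).trans_lt
      (by linarith [dist_le_of_step hv])⟩
  obtain ⟨s₀, h0, h1⟩ := s₀
  rcases h0.eq_or_lt with rfl | h0
  · refine of_step (G.src e₀) ?_
    have := Step.enterSrc (G := G) e₀
    rwa [onEdge, projIcc_left] at this
  rcases h1.eq_or_lt with rfl | h1
  · refine of_step (G.tgt e₀) ?_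
    have := Step.enterTgt (G := G) e₀
    rwa [onEdge, projIcc_right] at this
  have hr : 0 < min s₀ (G.len e₀ - s₀) := lt_min h0 (sub_pos.2 h1)
  refine ⟨min s₀ (G.len e₀ - s₀), hr, (finite_singleton e₀).subset ?_⟩
  generalize hr' : min s₀ (G.len e₀ - s₀) = r at hr
  rintro e ⟨s, hs⟩
  by_contra he
  -- For a point inside `e₀` the truncated distance is explicit: no point outside `e₀` is closer
  -- than the nearer endpoint.
  let g : G.Point → ℝ := Sum.elim (fun _ => r) fun p =>
    if p.1 = e₀ then min r |(p.2 : ℝ) - s₀| else r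
  have g0 : ∀ e, g (G.onEdge e 0) = r := fun e => by
    by_cases h : e = e₀
    · subst h
      simp only [g, onEdge, Sum.elim_inr, projIcc_left, if_true]
      grind
    · simp [g, onEdge, h]
  have g1 : ∀ e, g (G.onEdge e (G.len e)) = r := fun e => by
    by_cases h : e = e₀
    · subst h
      simp only [g, onEdge, Sum.elim_inr, projIcc_right, if_true]
      grind
    · simp [g, onEdge, h]
  have hg : ∀ x y c, G.Step x y c → |g x - g y| ≤ c := by
    rintro x y c (⟨e, s, t⟩ | e | e | e | e)
    · simp only [g, Sum.elim_inr]
      grind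
    · simp [g0]; simp [g, vertex]
    · simp [g0]; simp [g, vertex]
    · simp [g1]; simp [g, vertex]
    · simp [g1]; simp [g, vertex]
  have h := (abs_sub_le_dist_of_step hg (G.onEdge e s) (Sum.inr ⟨e₀, s₀, h0.le, h1.le⟩)).trans_lt hs
  rw [mem_singleton_iff] at he
  simp only [g, onEdge, Sum.elim_inr, he, if_true, if_false] at h
  simp only [sub_self, abs_zero] at h
  grind

/-- A compact set of points of the graph meets only finitely many edges. -/
lemma finite_edges_of_isCompact {K : Set G.Completion} (hK : IsCompact K)
    (hKr : K ⊆ range ((↑) : G.Point → G.Completion)) :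
    {e | ∃ s, ((G.onEdge e s : G.Point) : G.Completion) ∈ K}.Finite := by
  refine hK.induction_on
    (p := fun K => {e | ∃ s, ((G.onEdge e s : G.Point) : G.Completion) ∈ K}.Finite)
    (by simp) (fun s t hst ht => ht.subset ?_) (fun s t hs ht => (hs.union ht).subset ?_) ?_
  · rintro e ⟨r, hr⟩
    exact ⟨r, hst hr⟩
  · rintro e ⟨r, hr | hr⟩
    exacts [Or.inl ⟨r, hr⟩, Or.inr ⟨r, hr⟩]
  · intro x hx
    obtain ⟨x, rfl⟩ := hKr hx
    obtain ⟨r, hr, h⟩ := exists_ball_finite x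
    refine ⟨Metric.ball x r, nhdsWithin_le_nhds (Metric.ball_mem_nhds _ hr), h.subset ?_⟩
    rintro e ⟨s, hs⟩
    exact ⟨s, by simpa using hs⟩

lemma boundary_compl_subset_range : G.boundaryᶜ ⊆ range ((↑) : G.Point → G.Completion) := by
  rw [boundary, compl_compl]
  exact sdiff_subset

lemma vertex_mem_boundary {v : V} (hv : v ∈ G.bdry) : (G.vertex v : G.Completion) ∈ G.boundary :=
  fun h => h.2 ⟨v, hv, rfl⟩

/-- If the completion is compact, then all but finitely many edges are contained in a given
neighborhood of the boundary. -/
lemma finite_edges_of_boundary_subset [CompactSpace G.Completion] {O : Set G.Completion}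
    (hO : IsOpen O) (hb : G.boundary ⊆ O) :
    {e | ∃ s, ((G.onEdge e s : G.Point) : G.Completion) ∉ O}.Finite :=
  finite_edges_of_isCompact hO.isClosed_compl.isCompact
    ((compl_subset_compl.2 hb).trans boundary_compl_subset_range)

/-! ### The measure of the graph -/

lemma measurable_sigma_iff {α : Type*} [MeasurableSpace α] {F : Coord Edge → α} :
    Measurable F ↔ ∀ e, Measurable fun s => F ⟨e, s⟩ := by
  refine ⟨fun h e => h.comp fun s hs => ?_, fun h s hs => ?_⟩
  · exact MeasurableSpace.measurableSet_iInf.1 hs e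
  · exact MeasurableSpace.measurableSet_iInf.2 fun e => h e hs

lemma measurableSet_sigma_iff {S : Set (Coord Edge)} :
    MeasurableSet S ↔ ∀ e, MeasurableSet (Sigma.mk e ⁻¹' S) :=
  MeasurableSpace.measurableSet_iInf

lemma measurableEmbedding_sigma_mk (e : Edge) :
    MeasurableEmbedding (fun s => ⟨e, s⟩ : ℝ → Coord Edge) where
  injective := fun s t h => by simpa using h
  measurable := measurable_sigma_iff.1 measurable_id e
  measurableSet_image' := fun s hs => measurableSet_sigma_iff.2 fun e' => by
    by_cases h : e' = e
    · subst h
      rwa [preimage_image_eq _ fun s t h => by simpa using h]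
    · convert MeasurableSet.empty
      ext x
      simp [Ne.symm h]

variable (G)

lemma ae_vol_iff [Countable Edge] {P : Coord Edge → Prop} :
    (∀ᵐ p ∂G.vol, P p) ↔ ∀ e, ∀ᵐ s ∂volume.restrict (Icc 0 (G.len e)), P ⟨e, s⟩ := by
  rw [vol, Measure.ae_sum_iff]
  simp only [(measurableEmbedding_sigma_mk _).ae_map_iff]

lemma lintegral_vol (F : Coord Edge → ENNReal) :
    ∫⁻ p, F p ∂G.vol = ∑' e, ∫⁻ s in Icc 0 (G.len e), F ⟨e, s⟩ := by
  simp only [vol, lintegral_sum_measure, (measurableEmbedding_sigma_mk _).lintegral_map]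

lemma aestronglyMeasurable_vol_iff [Countable Edge] {F : Coord Edge → ℝ} :
    AEStronglyMeasurable F G.vol ↔
      ∀ e, AEStronglyMeasurable (fun s => F ⟨e, s⟩) (volume.restrict (Icc 0 (G.len e))) := by
  simp only [vol, aestronglyMeasurable_sum_measure_iff,
    (measurableEmbedding_sigma_mk _).aestronglyMeasurable_map_iff, Function.comp_def]

lemma map_le_vol (e : Edge) :
    (volume.restrict (Icc 0 (G.len e))).map (Sigma.mk e) ≤ G.vol := Measure.le_sum _ e

variable {G}

lemma MemLp.slice {F : Coord Edge → ℝ} {q : ENNReal} (h : MemLp F q G.vol) (e : Edge) :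
    MemLp (fun s => F ⟨e, s⟩) q (volume.restrict (Icc 0 (G.len e))) :=
  (measurableEmbedding_sigma_mk e).memLp_map_measure_iff.1 (h.mono_measure (G.map_le_vol e))

lemma integrable_slice {F : Coord Edge → ℝ} (h : Integrable F G.vol) (e : Edge) :
    Integrable (fun s => F ⟨e, s⟩) (volume.restrict (Icc 0 (G.len e))) :=
  (measurableEmbedding_sigma_mk e).integrable_map_iff.1 (h.mono_measure (G.map_le_vol e))

lemma integral_vol [Countable Edge] {F : Coord Edge → ℝ} (h : Integrable F G.vol) :
    ∫ p, F p ∂G.vol = ∑' e, ∫ s in Icc 0 (G.len e), F ⟨e, s⟩ := by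
  rw [vol, integral_sum_measure h]
  simp only [(measurableEmbedding_sigma_mk _).integral_map]

lemma integrable_of_finite_edges [Countable Edge] {F : Coord Edge → ℝ} {S : Finset Edge}
    (hS : ∀ e ∉ S, ∀ᵐ s ∂volume.restrict (Icc 0 (G.len e)), F ⟨e, s⟩ = 0)
    (hF : ∀ e ∈ S, Integrable (fun s => F ⟨e, s⟩) (volume.restrict (Icc 0 (G.len e)))) :
    Integrable F G.vol := by
  have h : ∀ e, Integrable (fun s => F ⟨e, s⟩) (volume.restrict (Icc 0 (G.len e))) := fun e => by
    by_cases he : e ∈ S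
    · exact hF e he
    · exact (integrable_zero _ _ _).congr ((hS e he).mono fun s hs => hs.symm)
  refine ⟨G.aestronglyMeasurable_vol_iff.2 fun e => (h e).1, ?_⟩
  rw [hasFiniteIntegral_iff_enorm, lintegral_vol, tsum_eq_sum (s := S)]
  · exact ENNReal.sum_lt_top.2 fun e _ => (h e).2
  · intro e he
    exact (lintegral_congr_ae ((hS e he).mono fun s hs => by simp [hs])).trans lintegral_zero

lemma integral_of_finite_edges [Countable Edge] {F : Coord Edge → ℝ} {S : Finset Edge}
    (hS : ∀ e ∉ S, ∀ᵐ s ∂volume.restrict (Icc 0 (G.len e)), F ⟨e, s⟩ = 0)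
    (hF : ∀ e ∈ S, Integrable (fun s => F ⟨e, s⟩) (volume.restrict (Icc 0 (G.len e)))) :
    ∫ p, F p ∂G.vol = ∑ e ∈ S, ∫ s in (0 : ℝ)..G.len e, F ⟨e, s⟩ := by
  rw [integral_vol (integrable_of_finite_edges hS hF), tsum_eq_sum (s := S)]
  · refine Finset.sum_congr rfl fun e _ => ?_
    rw [intervalIntegral.integral_of_le (G.len_pos e).le, integral_Icc_eq_integral_Ioc]
  · intro e he
    exact (integral_congr_ae (hS e he)).trans (integral_zero _ _)

lemma measurable_coord {f : G.Point → ℝ} (hf : Continuous f) : Measurable (G.coord f) :=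
  measurable_sigma_iff.2 fun e => (continuous_comp hf e).measurable

lemma measurableSet_coordSet {U : Set G.Completion} (hU : IsOpen U) :
    MeasurableSet (G.coordSet U) :=
  measurableSet_sigma_iff.2 fun e => (hU.preimage (continuous_coe_onEdge e)).measurableSet

/-- A property holds almost everywhere if it holds almost everywhere on the open edges. -/
lemma ae_vol_of_Ioo [Countable Edge] {P : Coord Edge → Prop}
    (h : ∀ e, ∀ᵐ s, s ∈ Ioo 0 (G.len e) → P ⟨e, s⟩) : ∀ᵐ p ∂G.vol, P p := by
  refine G.ae_vol_iff.2 fun e => ?_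
  rw [← Measure.restrict_congr_set Ioo_ae_eq_Icc]
  exact (ae_restrict_iff' measurableSet_Ioo).2 (h e)

/-! ### Integration by parts -/

lemma compDeriv_eq_deriv {f : G.Point → ℝ} {e : Edge} {s : ℝ} (hs : s ∈ Ioo 0 (G.len e)) :
    G.compDeriv f e s = deriv (G.comp f e) s :=
  derivWithin_of_mem_nhds (Icc_mem_nhds hs.1 hs.2)

lemma deriv₂_eq_deriv {f : G.Point → ℝ} {e : Edge} {s : ℝ} (hs : s ∈ Ioo 0 (G.len e)) :
    G.deriv₂ f ⟨e, s⟩ = deriv (G.compDeriv f e) s :=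
  derivWithin_of_mem_nhds (Icc_mem_nhds hs.1 hs.2)

lemma MemDmax.hasDerivAt {f : G.Point → ℝ} (hf : G.MemDmax f) {e : Edge} {s : ℝ}
    (hs : s ∈ Ioo 0 (G.len e)) : HasDerivAt (G.comp f e) (G.compDeriv f e s) s := by
  rw [compDeriv_eq_deriv hs]
  exact ((hf.differentiableOn e).differentiableAt (Icc_mem_nhds hs.1 hs.2)).hasDerivAt

lemma MemDmax.continuousOn_compDeriv {f : G.Point → ℝ} (hf : G.MemDmax f) (e : Edge) :
    ContinuousOn (G.compDeriv f e) (Icc 0 (G.len e)) := by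
  simpa [uIcc_of_le (G.len_pos e).le] using (hf.absolutelyContinuous_deriv e).continuousOn

lemma MemDmax.aestronglyMeasurable_deriv₁ [Countable Edge] {f : G.Point → ℝ} (hf : G.MemDmax f) :
    AEStronglyMeasurable (G.deriv₁ f) G.vol :=
  G.aestronglyMeasurable_vol_iff.2 fun e =>
    (hf.continuousOn_compDeriv e).aestronglyMeasurable measurableSet_Icc

lemma MemDmax.absolutelyContinuous {f : G.Point → ℝ} (hf : G.MemDmax f) (e : Edge) :
    AbsolutelyContinuousOnInterval (G.comp f e) 0 (G.len e) := by
  refine ContDiffOn.absolutelyContinuousOnInterval ?_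
  rw [uIcc_of_le (G.len_pos e).le, contDiffOn_one_iff_derivWithin (uniqueDiffOn_Icc (G.len_pos e))]
  exact ⟨hf.differentiableOn e, hf.continuousOn_compDeriv e⟩

lemma integrable_Icc_iff (e : Edge) {g : ℝ → ℝ} :
    Integrable g (volume.restrict (Icc 0 (G.len e))) ↔
      IntervalIntegrable g volume 0 (G.len e) := by
  rw [intervalIntegrable_iff_integrableOn_Icc_of_le (G.len_pos e).le, IntegrableOn]

lemma integral_congr_Ioo (e : Edge) {f g : ℝ → ℝ} (h : ∀ s ∈ Ioo 0 (G.len e), f s = g s) :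
    ∫ s in (0 : ℝ)..G.len e, f s = ∫ s in (0 : ℝ)..G.len e, g s := by
  rw [intervalIntegral.integral_of_le (G.len_pos e).le,
    intervalIntegral.integral_of_le (G.len_pos e).le, integral_Ioc_eq_integral_Ioo,
    integral_Ioc_eq_integral_Ioo]
  exact setIntegral_congr_fun measurableSet_Ioo h

lemma integrable_congr_Ioo (e : Edge) {f g : ℝ → ℝ} (h : ∀ s ∈ Ioo 0 (G.len e), f s = g s)
    (hg : Integrable g (volume.restrict (Icc 0 (G.len e)))) :
    Integrable f (volume.restrict (Icc 0 (G.len e))) := by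
  refine hg.congr ?_
  rw [← Measure.restrict_congr_set Ioo_ae_eq_Icc]
  exact (ae_restrict_iff' measurableSet_Ioo).2 (ae_of_all _ fun s hs => (h s hs).symm)

/-- The sum over the edges of the boundary terms of an integration by parts vanishes. -/
lemma sum_boundary_terms_eq_zero {f ψ : G.Point → ℝ} (hk : ∀ v ∉ G.bdry, G.Kirchhoff f v)
    (hψ : Continuous ψ) (hb : ∀ v ∈ G.bdry, ψ (G.vertex v) = 0) {S : Finset Edge}
    (hS : ∀ e ∉ S, ∀ s, G.comp ψ e s = 0) :
    ∑ e ∈ S, (G.compDeriv f e (G.len e) * G.comp ψ e (G.len e)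
      - G.compDeriv f e 0 * G.comp ψ e 0) = 0 := by
  classical
  have key : ∀ (p : Edge → V) (a : Edge → ℝ) (T : Finset V), (∀ e ∈ S, p e ∈ T) →
      (∀ v, {e | p e = v}.Finite) → (∀ e ∉ S, ψ (G.vertex (p e)) = 0) →
      ∑ e ∈ S, a e * ψ (G.vertex (p e)) =
        ∑ v ∈ T, (∑ᶠ (e : Edge) (_ : p e = v), a e) * ψ (G.vertex v) := by
    intro p a T hT hfin h0
    rw [← Finset.sum_fiberwise_of_maps_to hT]
    refine Finset.sum_congr rfl fun v _ => ?_
    rw [Finset.sum_congr rfl (g := fun e => a e * ψ (G.vertex v)), ← Finset.sum_mul]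
    -- If `ψ` does not vanish at `v`, every edge of the fiber over `v` lies in `S`, so the sum over
    -- `S` is the full sum in the Kirchhoff condition.
    · by_cases hv : ψ (G.vertex v) = 0
      · simp [hv]
      · congr 1
        refine (finsum_mem_eq_sum_of_inter_support_eq (s := {e | p e = v}) a ?_).symm
        ext e
        simp only [Finset.coe_filter, mem_inter_iff, mem_ofPred_eq]
        refine and_congr_left fun _ => ⟨fun h => ⟨?_, h⟩, fun h => h.2⟩
        by_contra he
        exact hv (h ▸ h0 e he)
    · intro e he
      rw [(Finset.mem_filter.1 he).2]
  let T := S.image G.src ∪ S.image G.tgt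
  have h1 := key G.src (fun e => G.compDeriv f e 0) T
    (fun e he => Finset.mem_union_left _ (Finset.mem_image_of_mem _ he))
    (fun v => (G.finite_incident v).subset fun e he => Or.inl he)
    (fun e he => by rw [← comp_zero hψ, hS e he])
  have h2 := key G.tgt (fun e => -G.compDeriv f e (G.len e)) T
    (fun e he => Finset.mem_union_right _ (Finset.mem_image_of_mem _ he))
    (fun v => (G.finite_incident v).subset fun e he => Or.inr he)
    (fun e he => by rw [← comp_len hψ, hS e he])
  have h3 : ∑ e ∈ S, (G.compDeriv f e (G.len e) * G.comp ψ e (G.len e)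
      - G.compDeriv f e 0 * G.comp ψ e 0) =
      -(∑ e ∈ S, G.compDeriv f e 0 * ψ (G.vertex (G.src e)) +
        ∑ e ∈ S, -G.compDeriv f e (G.len e) * ψ (G.vertex (G.tgt e))) := by
    rw [← Finset.sum_add_distrib, ← Finset.sum_neg_distrib]
    refine Finset.sum_congr rfl fun e _ => ?_
    rw [comp_zero hψ, comp_len hψ]
    ring
  rw [h3, h1, h2, ← Finset.sum_add_distrib, neg_eq_zero]
  refine Finset.sum_eq_zero fun v _ => ?_
  by_cases hv : v ∈ G.bdry
  · simp [hb v hv]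
  · rw [← add_mul]
    exact mul_eq_zero_of_left (hk v hv) _

lemma comp_eq_zero_of_forall_mem {O : Set G.Completion} {ψ : G.Point → ℝ}
    (h0 : ∀ x : G.Point, (x : G.Completion) ∈ O → ψ x = 0) {e : Edge}
    (he : e ∉ {e | ∃ s, ((G.onEdge e s : G.Point) : G.Completion) ∉ O}) (s : ℝ) :
    G.comp ψ e s = 0 := by
  simp only [mem_ofPred_eq, not_exists, not_not] at he
  exact h0 _ (he s)

/-- Only finitely many edges contribute, and on each the product is a continuous function times an
integrable derivative. No finite energy of `f` is needed. -/
lemma integrable_deriv₁_mul_deriv₁ [Countable Edge] [CompactSpace G.Completion]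
    {f ψ : G.Point → ℝ} (hf : G.MemDmax f)
    (hac : ∀ e, AbsolutelyContinuousOnInterval (G.comp ψ e) 0 (G.len e))
    {O : Set G.Completion} (hO : IsOpen O) (hb : G.boundary ⊆ O)
    (h0 : ∀ x : G.Point, (x : G.Completion) ∈ O → ψ x = 0) :
    Integrable (fun p => G.deriv₁ f p * G.deriv₁ ψ p) G.vol := by
  have hfin := finite_edges_of_boundary_subset hO hb
  refine integrable_of_finite_edges (S := hfin.toFinset) (fun e he => ?_) fun e _ => ?_
  · rw [Finite.mem_toFinset] at he
    refine ae_of_all _ fun s => ?_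
    have : G.comp ψ e = fun _ => 0 := funext (comp_eq_zero_of_forall_mem h0 he)
    simp [deriv₁, compDeriv, this]
  · refine integrable_congr_Ioo e (g := fun s => G.compDeriv f e s * deriv (G.comp ψ e) s)
      (fun s hs => ?_) ((integrable_Icc_iff e).2 ?_)
    · simp only [deriv₁]
      rw [compDeriv_eq_deriv (f := ψ) hs]
    · exact (hac e).intervalIntegrable_deriv.continuousOn_mul
        (hf.absolutelyContinuous_deriv e).continuousOn

/-- Integration by parts against a function which vanishes near the boundary. -/
theorem integral_neg_deriv₂_mul [Countable Edge] [CompactSpace G.Completion]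
    {f ψ : G.Point → ℝ} (hf : G.MemDmax f) (hψ : Continuous ψ)
    (hac : ∀ e, AbsolutelyContinuousOnInterval (G.comp ψ e) 0 (G.len e))
    {O : Set G.Completion} (hO : IsOpen O) (hb : G.boundary ⊆ O)
    (h0 : ∀ x : G.Point, (x : G.Completion) ∈ O → ψ x = 0) :
    ∫ p, -G.deriv₂ f p * G.coord ψ p ∂G.vol = ∫ p, G.deriv₁ f p * G.deriv₁ ψ p ∂G.vol := by
  have hfin := finite_edges_of_boundary_subset hO hb
  have hS : ∀ e ∉ hfin.toFinset, ∀ s, G.comp ψ e s = 0 := fun e he =>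
    comp_eq_zero_of_forall_mem h0 (by rwa [Finite.mem_toFinset] at he)
  have hd : ∀ e ∉ hfin.toFinset, ∀ s, G.compDeriv ψ e s = 0 := fun e he s => by
    have : G.comp ψ e = fun _ => 0 := funext (hS e he)
    simp [compDeriv, this]
  have hi : ∀ e, IntervalIntegrable (fun s => deriv (G.compDeriv f e) s * G.comp ψ e s)
      volume 0 (G.len e) := fun e =>
    (hf.absolutelyContinuous_deriv e).intervalIntegrable_deriv.mul_continuousOn
      (hac e).continuousOn
  rw [integral_of_finite_edges (S := hfin.toFinset), integral_of_finite_edges (S := hfin.toFinset),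
    ← sub_eq_zero, ← Finset.sum_sub_distrib, ← neg_eq_zero, ← Finset.sum_neg_distrib]
  · refine (Finset.sum_congr rfl fun e _ => ?_).trans (sum_boundary_terms_eq_zero hf.kirchhoff hψ
      (fun v hv => h0 _ (hb (vertex_mem_boundary hv))) hS)
    have h := (hf.absolutelyContinuous_deriv e).integral_mul_deriv_eq_deriv_mul (hac e)
    rw [integral_congr_Ioo e (g := fun s => -(deriv (G.compDeriv f e) s * G.comp ψ e s)),
      integral_congr_Ioo e (f := fun s => G.deriv₁ f ⟨e, s⟩ * G.deriv₁ ψ ⟨e, s⟩)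
        (g := fun s => G.compDeriv f e s * deriv (G.comp ψ e) s), h,
      intervalIntegral.integral_neg]
    · ring
    · intro s hs
      simp only [deriv₁]
      rw [compDeriv_eq_deriv (f := ψ) hs]
    · intro s hs
      rw [deriv₂_eq_deriv hs, neg_mul, coord]
  · exact fun e he => ae_of_all _ fun s => by simp [deriv₁, hd e he]
  · exact fun e _ => integrable_slice (integrable_deriv₁_mul_deriv₁ hf hac hO hb h0) e
  · exact fun e he => ae_of_all _ fun s => by simp [coord, hS e he]
  · refine fun e _ => integrable_congr_Ioo e
      (g := fun s => -(deriv (G.compDeriv f e) s * G.comp ψ e s)) (fun s hs => ?_)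
      ((integrable_Icc_iff e).2 (hi e).neg)
    rw [deriv₂_eq_deriv hs, neg_mul, coord]

/-! ### Hölder continuity of functions of finite energy -/

lemma vol_apply {S : Set (Coord Edge)} (hS : MeasurableSet S) :
    G.vol S = ∑' e, volume (Sigma.mk e ⁻¹' S ∩ Icc 0 (G.len e)) := by
  rw [vol, Measure.sum_apply _ hS]
  refine tsum_congr fun e => ?_
  rw [(measurableEmbedding_sigma_mk e).map_apply,
    Measure.restrict_apply (measurableSet_sigma_iff.1 hS e)]

lemma vol_image_mk_le (e : Edge) {I : Set ℝ} (hI : MeasurableSet I) :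
    G.vol ((fun s => ⟨e, s⟩) '' I) ≤ volume I := by
  rw [vol_apply ((measurableEmbedding_sigma_mk e).measurableSet_image.2 hI), tsum_eq_single e]
  · refine measure_mono fun s hs => ?_
    obtain ⟨t, ht, h⟩ := hs.1
    simp only [Sigma.mk.injEq, heq_eq_eq, true_and] at h
    exact h ▸ ht
  · intro e' he'
    convert measure_empty (μ := (volume : Measure ℝ))
    ext s
    simp [Ne.symm he']

/-- The image of a path of length `L` from `x` to `y` is a set of measure at most `L` on which a
continuous function takes all values between its values at `x` and `y`. -/
lemma Path.exists_cover {x y : G.Point} {L : ℝ} (h : G.Path x y L) :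
    ∃ K : Set (Coord Edge), MeasurableSet K ∧ (∀ e, Sigma.mk e ⁻¹' K ⊆ Icc 0 (G.len e)) ∧
      G.vol K ≤ ENNReal.ofReal L ∧
      ∀ f : G.Point → ℝ, Continuous f → uIcc (f x) (f y) ⊆ insert (f x) (G.coord f '' K) := by
  induction h with
  -- The inserted value `f x` is what makes a path that traverses no edge admissible.
  | refl => exact ⟨∅, MeasurableSet.empty, by simp, by simp, by simp⟩
  | @tail y z L c hp hs ih =>
    obtain ⟨K, hK, hKI, hvol, hf⟩ := ih
    have of_zero : G.Step y z 0 → ∃ K : Set (Coord Edge), MeasurableSet K ∧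
        (∀ e, Sigma.mk e ⁻¹' K ⊆ Icc 0 (G.len e)) ∧ G.vol K ≤ ENNReal.ofReal (L + 0) ∧
        ∀ f : G.Point → ℝ, Continuous f →
          uIcc (f x) (f z) ⊆ insert (f x) (G.coord f '' K) := fun h =>
      ⟨K, hK, hKI, by simpa using hvol, fun f hc => apply_eq_of_step hc h ▸ hf f hc⟩
    cases hs with
    | along e s t =>
      refine ⟨K ∪ (fun r => ⟨e, r⟩) '' uIcc (s : ℝ) t, hK.union
        ((measurableEmbedding_sigma_mk e).measurableSet_image.2 measurableSet_uIcc), ?_, ?_, ?_⟩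
      · intro e' r hr
        rcases hr with hr | ⟨r', hr', h⟩
        · exact hKI e' hr
        · simp only [Sigma.mk.injEq] at h
          obtain ⟨rfl, h⟩ := h
          rw [← eq_of_heq h]
          exact (uIcc_subset_Icc s.2 t.2) hr'
      · refine (measure_union_le _ _).trans ?_
        rw [ENNReal.ofReal_add hp.nonneg (abs_nonneg _)]
        refine add_le_add hvol ((vol_image_mk_le e measurableSet_uIcc).trans ?_)
        rw [Real.volume_interval]
      · intro f hc
        refine uIcc_subset_uIcc_union_uIcc.trans (union_subset ((hf f hc).trans ?_) ?_)
        · exact insert_subset_insert (image_mono subset_union_left)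
        · rw [← onEdge_coe, ← onEdge_coe]
          refine (intermediate_value_uIcc (continuous_comp hc e).continuousOn).trans ?_
          rintro _ ⟨r, hr, rfl⟩
          exact Or.inr ⟨⟨e, r⟩, Or.inr ⟨r, hr, rfl⟩, rfl⟩
    | leaveSrc e => exact of_zero (Step.leaveSrc e)
    | enterSrc e => exact of_zero (Step.enterSrc e)
    | leaveTgt e => exact of_zero (Step.leaveTgt e)
    | enterTgt e => exact of_zero (Step.enterTgt e)

/-- The one-dimensional area inequality, edge by edge. Working with the image of a set instead of
integrating along a path counts an edge once even if the path uses it repeatedly. -/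
lemma volume_image_coord_le [Countable Edge] {f : G.Point → ℝ}
    (hf : ∀ e, DifferentiableOn ℝ (G.comp f e) (Icc 0 (G.len e))) {K : Set (Coord Edge)}
    (hK : MeasurableSet K) (hKI : ∀ e, Sigma.mk e ⁻¹' K ⊆ Icc 0 (G.len e)) :
    volume (G.coord f '' K) ≤ ∫⁻ p in K, ‖G.deriv₁ f p‖ₑ ∂G.vol := by
  let S : Edge → Set ℝ := fun e => {s | (⟨e, s⟩ : Coord Edge) ∈ K}
  have hS : ∀ e, MeasurableSet (S e) := measurableSet_sigma_iff.1 hK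
  have hSI : ∀ e, S e ⊆ Icc 0 (G.len e) := hKI
  have h1 : G.coord f '' K ⊆ ⋃ e, G.comp f e '' S e := by
    rintro _ ⟨⟨e, s⟩, hs, rfl⟩
    exact mem_iUnion.2 ⟨e, s, hs, rfl⟩
  refine (measure_mono h1).trans ((measure_iUnion_le _).trans ?_)
  rw [← lintegral_indicator hK, lintegral_vol]
  refine ENNReal.tsum_le_tsum fun e => ?_
  have h2 : ∀ s ∈ S e, HasFDerivWithinAt (G.comp f e)
      (ContinuousLinearMap.toSpanSingleton ℝ (G.compDeriv f e s)) (S e) s :=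
    fun s hs => ((hf e s (hSI e hs)).hasDerivWithinAt.mono (hSI e)).hasFDerivWithinAt
  refine (addHaar_image_le_lintegral_abs_det_fderiv volume (hS e) h2).trans ?_
  have h3 : ∀ s, K.indicator (fun p => ‖G.deriv₁ f p‖ₑ) ⟨e, s⟩ =
      (S e).indicator (fun s => ‖G.compDeriv f e s‖ₑ) s := fun s => rfl
  simp only [h3]
  rw [lintegral_indicator (hS e), Measure.restrict_restrict (hS e), inter_eq_left.2 (hSI e)]
  refine lintegral_mono fun s => ?_
  simp [ContinuousLinearMap.det, Real.enorm_eq_ofReal_abs]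

/-- A function of finite energy is Hölder continuous. -/
theorem abs_sub_le_eLpNorm_mul_sqrt [Countable Edge] {f : G.Point → ℝ} (hf : G.MemDmax f)
    (hf' : MemLp (G.deriv₁ f) 2 G.vol) (x y : G.Point) :
    |f x - f y| ≤ (eLpNorm (G.deriv₁ f) 2 G.vol).toReal * √(dist x y) := by
  have key : ∀ L, G.Path x y L → |f x - f y| ≤ (eLpNorm (G.deriv₁ f) 2 G.vol).toReal * √L := by
    intro L hL
    obtain ⟨K, hK, hKI, hvol, hcov⟩ := hL.exists_cover
    have h1 : ENNReal.ofReal |f x - f y| ≤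
        eLpNorm (G.deriv₁ f) 2 G.vol * ENNReal.ofReal L ^ (1 / 2 : ℝ) := by
      calc ENNReal.ofReal |f x - f y| = volume (uIcc (f x) (f y)) := by
            rw [Real.volume_interval, abs_sub_comm]
        _ ≤ volume (insert (f x) (G.coord f '' K)) := measure_mono (hcov f hf.continuous)
        _ ≤ volume (G.coord f '' K) := by
          rw [insert_eq]
          exact (measure_union_le _ _).trans (by simp)
        _ ≤ ∫⁻ p in K, ‖G.deriv₁ f p‖ₑ ∂G.vol := volume_image_coord_le hf.differentiableOn hK hKI
        _ = eLpNorm (G.deriv₁ f) 1 (G.vol.restrict K) := by rw [eLpNorm_one_eq_lintegral_enorm]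
        -- Cauchy–Schwarz on `K`, whose volume is at most the length of the path.
        _ ≤ eLpNorm (G.deriv₁ f) 2 (G.vol.restrict K) * (G.vol.restrict K) univ ^
            (1 / (1 : ENNReal).toReal - 1 / (2 : ENNReal).toReal) :=
          eLpNorm_le_eLpNorm_mul_rpow_measure_univ (by norm_num) hf'.1.restrict
        _ ≤ _ := by
          have : 1 / (1 : ENNReal).toReal - 1 / (2 : ENNReal).toReal = 1 / 2 := by norm_num
          rw [this, Measure.restrict_apply_univ]
          gcongr
          exact Measure.restrict_le_self
    have h2 := ENNReal.toReal_mono (ENNReal.mul_ne_top hf'.2.ne (by simp)) h1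
    rwa [ENNReal.toReal_ofReal (abs_nonneg _), ENNReal.toReal_mul, ← ENNReal.toReal_rpow,
      ENNReal.toReal_ofReal hL.nonneg, ← Real.sqrt_eq_rpow] at h2
  -- The infimum of path lengths need not be attained, so the bound is passed to the limit from
  -- above.
  have hlim : Tendsto (fun r => (eLpNorm (G.deriv₁ f) 2 G.vol).toReal * √r) (𝓝[>] dist x y)
      (𝓝 ((eLpNorm (G.deriv₁ f) 2 G.vol).toReal * √(dist x y))) :=
    ((Real.continuous_sqrt.tendsto _).const_mul _).mono_left nhdsWithin_le_nhds
  refine ge_of_tendsto hlim (eventually_nhdsWithin_of_forall fun r hr => ?_)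
  obtain ⟨L, hLr, hL⟩ := exists_path_lt hr
  exact (key L hL).trans (by gcongr)

/-! ### The maximal domain is closed under subtraction -/

/-- The default value `0` of `derivWithin` off the closure lets identities for the derivative hold
at all coordinates, not just those on the edge. -/
lemma compDeriv_of_notMem {f : G.Point → ℝ} {e : Edge} {s : ℝ} (hs : s ∉ Icc 0 (G.len e)) :
    G.compDeriv f e s = 0 :=
  derivWithin_zero_of_notMem_closure (by rwa [isClosed_Icc.closure_eq])

lemma MemDmax.compDeriv_sub {f g : G.Point → ℝ} (hf : G.MemDmax f) (hg : G.MemDmax g) (e : Edge) :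
    G.compDeriv (f - g) e = G.compDeriv f e - G.compDeriv g e := by
  ext s
  by_cases hs : s ∈ Icc 0 (G.len e)
  · exact derivWithin_sub (hf.differentiableOn e s hs) (hg.differentiableOn e s hs)
  · simp [compDeriv_of_notMem hs]

lemma MemDmax.deriv₁_sub {f g : G.Point → ℝ} (hf : G.MemDmax f) (hg : G.MemDmax g) :
    G.deriv₁ (f - g) = G.deriv₁ f - G.deriv₁ g := by
  ext p
  exact congrFun (hf.compDeriv_sub hg p.1) p.2

/-- The first derivatives are only absolutely continuous, hence differentiable almost everywhere. -/
lemma MemDmax.deriv₂_sub [Countable Edge] {f g : G.Point → ℝ} (hf : G.MemDmax f)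
    (hg : G.MemDmax g) : G.deriv₂ (f - g) =ᵐ[G.vol] G.deriv₂ f - G.deriv₂ g := by
  refine ae_vol_of_Ioo fun e => ?_
  filter_upwards [(hf.absolutelyContinuous_deriv e).ae_differentiableAt,
    (hg.absolutelyContinuous_deriv e).ae_differentiableAt] with s h1 h2 hs
  rw [uIcc_of_le (G.len_pos e).le] at h1 h2
  have hs' := Ioo_subset_Icc_self hs
  rw [Pi.sub_apply, deriv₂_eq_deriv hs, deriv₂_eq_deriv hs, deriv₂_eq_deriv hs,
    hf.compDeriv_sub hg]
  exact deriv_sub (h1 hs') (h2 hs')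

lemma Kirchhoff.sub {f g : G.Point → ℝ} (hf : G.MemDmax f) (hg : G.MemDmax g) {v : V}
    (h1 : G.Kirchhoff f v) (h2 : G.Kirchhoff g v) : G.Kirchhoff (f - g) v := by
  have hs : {e | G.src e = v}.Finite := (G.finite_incident v).subset fun e he => Or.inl he
  have ht : {e | G.tgt e = v}.Finite := (G.finite_incident v).subset fun e he => Or.inr he
  unfold Kirchhoff at *
  have e1 := finsum_mem_sub_distrib (f := fun e => G.compDeriv f e 0)
    (g := fun e => G.compDeriv g e 0) hs
  have e2 := finsum_mem_sub_distrib (f := fun e => -G.compDeriv f e (G.len e))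
    (g := fun e => -G.compDeriv g e (G.len e)) ht
  simp only [mem_ofPred_eq] at e1 e2
  simp only [hf.compDeriv_sub hg, Pi.sub_apply]
  rw [e1]
  simp only [neg_sub_neg, neg_sub] at e2 ⊢
  rw [e2]
  linarith

lemma MemDmax.sub [Countable Edge] {f g : G.Point → ℝ} (hf : G.MemDmax f) (hg : G.MemDmax g) :
    G.MemDmax (f - g) where
  continuous := hf.continuous.sub hg.continuous
  differentiableOn e := (hf.differentiableOn e).sub (hg.differentiableOn e)
  absolutelyContinuous_deriv e := by
    rw [hf.compDeriv_sub hg]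
    exact (hf.absolutelyContinuous_deriv e).sub (hg.absolutelyContinuous_deriv e)
  memLp := hf.memLp.sub hg.memLp
  memLp_deriv₂ := (memLp_congr_ae (hf.deriv₂_sub hg)).2 (hf.memLp_deriv₂.sub hg.memLp_deriv₂)
  kirchhoff v hv := (hf.kirchhoff v hv).sub hf hg (hg.kirchhoff v hv)

/-! ### Limits of sequences of functions of finite energy -/

lemma eLpNorm_slice_le {F : Coord Edge → ℝ} {q : ENNReal} (e : Edge) :
    eLpNorm (fun s => F ⟨e, s⟩) q (volume.restrict (Icc 0 (G.len e))) ≤ eLpNorm F q G.vol := by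
  have h := (measurableEmbedding_sigma_mk e).eLpNorm_map_measure (g := F) (p := q)
    (μ := volume.restrict (Icc 0 (G.len e)))
  exact h.symm.le.trans (eLpNorm_mono_measure F (G.map_le_vol e))

/-- A function of finite energy is bounded by its Sobolev norm. -/
lemma exists_abs_le [Countable Edge] [CompactSpace G.Completion] (e : Edge) :
    ∃ A B : ℝ, ∀ f : G.Point → ℝ, G.MemDmax f → MemLp (G.deriv₁ f) 2 G.vol → ∀ x,
      |f x| ≤ A * (eLpNorm (G.coord f) 2 G.vol).toReal
        + B * (eLpNorm (G.deriv₁ f) 2 G.vol).toReal := by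
  -- By Hölder continuity over the finite diameter, `|f|` exceeds `|f x| - B ‖f'‖₂` on all of `e`;
  -- taking the `L²` norm of this constant over `e` produces the factor `√(len e)`.
  refine ⟨(√(G.len e))⁻¹, √(Metric.diam (univ : Set G.Completion)), fun f hf hf' x => ?_⟩
  set D := Metric.diam (univ : Set G.Completion)
  set B := (eLpNorm (G.deriv₁ f) 2 G.vol).toReal
  have hlen := G.len_pos e
  have h1 : ∀ s, |f x| - √D * B ≤ |G.comp f e s| := fun s => by
    have h2 : dist x (G.onEdge e s) ≤ D := by
      rw [← UniformSpace.Completion.dist_eq]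
      exact Metric.dist_le_diam_of_mem isCompact_univ.isBounded (mem_univ _) (mem_univ _)
    have h3 := abs_sub_le_eLpNorm_mul_sqrt hf hf' x (G.onEdge e s)
    have h4 : B * √(dist x (G.onEdge e s)) ≤ √D * B := by
      rw [mul_comm]
      gcongr
    have h5 := abs_sub_abs_le_abs_sub (f x) (f (G.onEdge e s))
    change _ ≤ |f (G.onEdge e s)|
    linarith
  rcases le_or_gt (|f x| - √D * B) 0 with h0 | h0
  · have : 0 ≤ (√(G.len e))⁻¹ * (eLpNorm (G.coord f) 2 G.vol).toReal := by positivity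
    linarith
  have hne : volume.restrict (Icc 0 (G.len e)) ≠ 0 := by
    rw [Ne, Measure.restrict_eq_zero]
    simp [hlen]
  have h2 : eLpNorm (fun _ : ℝ => |f x| - √D * B) 2 (volume.restrict (Icc 0 (G.len e)))
      ≤ eLpNorm (G.coord f) 2 G.vol :=
    (eLpNorm_mono_real (g := fun s => |G.comp f e s|) fun s => by
      rw [Real.norm_of_nonneg h0.le]
      exact h1 s).trans (by
        simp only [← Real.norm_eq_abs]
        rw [eLpNorm_norm (fun s => G.comp f e s)]
        exact eLpNorm_slice_le (F := G.coord f) e)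
  rw [eLpNorm_const _ (by norm_num) hne, Measure.restrict_apply_univ, Real.volume_Icc, sub_zero]
    at h2
  have h3 := ENNReal.toReal_mono hf.memLp.2.ne h2
  rw [ENNReal.toReal_mul, ← ENNReal.toReal_rpow, ENNReal.toReal_ofReal hlen.le, toReal_enorm,
    Real.norm_of_nonneg h0.le] at h3
  have h4 : (1 : ℝ) / (2 : ENNReal).toReal = 1 / 2 := by norm_num
  rw [h4, ← Real.sqrt_eq_rpow] at h3
  have h5 : 0 < √(G.len e) := Real.sqrt_pos.2 hlen
  rw [← sub_le_iff_le_add, inv_mul_eq_div, le_div_iff₀ h5]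
  exact h3

lemma uniformContinuous_of_abs_sub_le {f : G.Point → ℝ} {M : ℝ}
    (h : ∀ x y, |f x - f y| ≤ M * √(dist x y)) : UniformContinuous f := by
  have h1 : Tendsto (fun p : G.Point × G.Point => dist p.1 p.2) (uniformity _) (𝓝 0) :=
    tendsto_uniformity_iff_dist_tendsto_zero.1 tendsto_id
  have h2 := ((Real.continuous_sqrt.tendsto 0).comp h1).const_mul M
  rw [Real.sqrt_zero, mul_zero] at h2
  exact tendsto_uniformity_iff_dist_tendsto_zero.2
    (squeeze_zero (fun _ => dist_nonneg) (fun p => h p.1 p.2) h2)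

lemma _root_.AbsolutelyContinuousOnInterval.congr {f g : ℝ → ℝ} {a b : ℝ}
    (hf : AbsolutelyContinuousOnInterval f a b) (h : ∀ x ∈ uIcc a b, f x = g x) :
    AbsolutelyContinuousOnInterval g a b := by
  refine Tendsto.congr' ?_ hf
  filter_upwards [mem_inf_of_right (mem_principal_self _)] with E hE
  refine Finset.sum_congr rfl fun i hi => ?_
  rw [h _ (hE.1 i hi).1, h _ (hE.1 i hi).2]

lemma MemDmax.integral_compDeriv {f : G.Point → ℝ} (hf : G.MemDmax f) {e : Edge} {s : ℝ}
    (hs : s ∈ Icc 0 (G.len e)) :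
    ∫ r in Ioc 0 s, G.compDeriv f e r = G.comp f e s - G.comp f e 0 := by
  have hsub : uIcc 0 s ⊆ uIcc 0 (G.len e) := by
    rw [uIcc_of_le hs.1, uIcc_of_le (G.len_pos e).le]
    exact Icc_subset_Icc_right hs.2
  rw [← ((hf.absolutelyContinuous e).mono hsub).integral_deriv_eq_sub,
    intervalIntegral.integral_of_le hs.1, integral_Ioc_eq_integral_Ioo,
    integral_Ioc_eq_integral_Ioo]
  exact setIntegral_congr_fun measurableSet_Ioo fun r hr =>
    compDeriv_eq_deriv ⟨hr.1, hr.2.trans_le hs.2⟩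

/-- `L²` convergence gives `L¹` convergence on one edge, since its length is finite; the whole graph
is not assumed to have finite volume. -/
lemma tendsto_eLpNorm_one_slice {F : ℕ → Coord Edge → ℝ} {g : Coord Edge → ℝ}
    (hF : ∀ n, AEStronglyMeasurable (F n) G.vol) (hg : AEStronglyMeasurable g G.vol)
    (h : Tendsto (fun n => eLpNorm (F n - g) 2 G.vol) atTop (𝓝 0)) (e : Edge) :
    Tendsto (fun n => eLpNorm ((fun s => F n ⟨e, s⟩) - fun s => g ⟨e, s⟩) 1
      (volume.restrict (Icc 0 (G.len e)))) atTop (𝓝 0) := by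
  have hc : ENNReal.ofReal (G.len e) ^ (1 / 2 : ℝ) ≠ ⊤ := by simp
  have h2 := ENNReal.Tendsto.mul_const (b := ENNReal.ofReal (G.len e) ^ (1 / 2 : ℝ)) h (Or.inr hc)
  rw [zero_mul] at h2
  refine tendsto_of_tendsto_of_tendsto_of_le_of_le tendsto_const_nhds h2 (fun n => zero_le)
    fun n => ?_
  have hm : AEStronglyMeasurable (fun s => (F n - g) ⟨e, s⟩)
      (volume.restrict (Icc 0 (G.len e))) :=
    (measurableEmbedding_sigma_mk e).aestronglyMeasurable_map_iff.1
      (((hF n).sub hg).mono_measure (G.map_le_vol e))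
  refine (eLpNorm_le_eLpNorm_mul_rpow_measure_univ (p := 1) (q := 2) (by norm_num) hm).trans ?_
  have : 1 / (1 : ENNReal).toReal - 1 / (2 : ENNReal).toReal = 1 / 2 := by norm_num
  rw [this, Measure.restrict_apply_univ, Real.volume_Icc, sub_zero]
  gcongr
  exact eLpNorm_slice_le (F := F n - g) e

lemma isRegularRepresentative_of_isEmpty [IsEmpty Edge] (f : G.L2) :
    G.IsRegularRepresentative f fun _ => 0 where
  ae_eq := Eventually.of_forall fun p => isEmptyElim p.1
  continuous := continuous_const
  absolutelyContinuous e := isEmptyElim e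
  memLp_deriv := by
    have : G.deriv₁ (G.res fun _ => 0) = 0 := funext fun p => isEmptyElim p.1
    rw [this]
    exact MemLp.zero

/-- A function on the graph whose components are primitives of an `L²` function extends to a
regular function on the completion. -/
lemma isRegularRepresentative_extension [Countable Edge] {U : G.Point → ℝ}
    (hU : UniformContinuous U) {g : Coord Edge → ℝ} (hg : MemLp g 2 G.vol)
    (hint : ∀ e, ∀ s ∈ Icc 0 (G.len e),
      G.comp U e s - G.comp U e 0 = ∫ r in Ioc 0 s, g ⟨e, r⟩)
    {f : G.L2} (hf : f =ᵐ[G.vol] G.coord U) :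
    G.IsRegularRepresentative f (UniformSpace.Completion.extension U) ∧
      G.deriv₁ (G.res (UniformSpace.Completion.extension U)) =ᵐ[G.vol] g := by
  have hres : G.res (UniformSpace.Completion.extension U) = U :=
    funext fun x => UniformSpace.Completion.extension_coe hU x
  have hgi : ∀ e, IntervalIntegrable (fun s => g ⟨e, s⟩) volume 0 (G.len e) := fun e =>
    (integrable_Icc_iff e).1 ((MemLp.slice hg e).integrable (by norm_num))
  have hprim : ∀ e, ∀ s ∈ Icc 0 (G.len e),
      G.comp U e 0 + ∫ r in (0 : ℝ)..s, g ⟨e, r⟩ = G.comp U e s := fun e s hs => by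
    rw [intervalIntegral.integral_of_le hs.1, ← hint e s hs]
    ring
  -- Lebesgue differentiation of the primitive.
  have hd : G.deriv₁ U =ᵐ[G.vol] g := by
    refine ae_vol_of_Ioo fun e => ?_
    filter_upwards [(hgi e).ae_hasDerivAt_integral] with s h hs
    rw [uIcc_of_le (G.len_pos e).le] at h
    have h1 := (h (Ioo_subset_Icc_self hs) 0 (left_mem_Icc.2 (G.len_pos e).le)).const_add
      (G.comp U e 0)
    have h2 : G.comp U e =ᶠ[𝓝 s] fun s => G.comp U e 0 + ∫ r in (0 : ℝ)..s, g ⟨e, r⟩ := by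
      filter_upwards [Icc_mem_nhds hs.1 hs.2] with r hr using (hprim e r hr).symm
    rw [deriv₁, compDeriv_eq_deriv hs, (h1.congr_of_eventuallyEq h2).deriv]
  refine ⟨⟨by rwa [hres], UniformSpace.Completion.continuous_extension, fun e => ?_, ?_⟩, ?_⟩
  · rw [hres]
    refine AbsolutelyContinuousOnInterval.congr
      (f := fun s => G.comp U e 0 + ∫ r in (0 : ℝ)..s, g ⟨e, r⟩) ?_ ?_
    · exact (LipschitzWith.const (G.comp U e 0)).lipschitzOnWith.absolutelyContinuousOnInterval.add
        ((hgi e).absolutelyContinuousOnInterval_intervalIntegral left_mem_uIcc)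
    · rw [uIcc_of_le (G.len_pos e).le]
      exact hprim e
  · rw [hres]
    exact (memLp_congr_ae hd).2 hg
  · rwa [hres]

/-- A sequence in the maximal domain which is Cauchy for the energy and converges in `L²` has a
limit which is continuous on the completion and of finite energy. -/
theorem exists_isRegularRepresentative [Countable Edge] [CompactSpace G.Completion]
    {u : ℕ → G.Point → ℝ} {f : G.L2} (hu : ∀ n, G.MemDmax (u n))
    (hd : ∀ n, MemLp (G.deriv₁ (u n)) 2 G.vol)
    (hcau : Tendsto (fun p : ℕ × ℕ => eLpNorm (G.deriv₁ (u p.1 - u p.2)) 2 G.vol) atTop (𝓝 0))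
    (hlim : Tendsto (fun n => eLpNorm (G.coord (u n) - ⇑f) 2 G.vol) atTop (𝓝 0)) :
    ∃ F, G.IsRegularRepresentative f F ∧
      Tendsto (fun n => eLpNorm (G.deriv₁ (u n) - G.deriv₁ (G.res F)) 2 G.vol) atTop (𝓝 0) := by
  -- The uniform bound `exists_abs_le` needs a reference edge; without edges the measure is zero.
  rcases isEmpty_or_nonempty Edge with hE | ⟨⟨e₀⟩⟩
  · have : G.vol = 0 := by simp [vol]
    exact ⟨_, isRegularRepresentative_of_isEmpty f, by simp [this]⟩
  let X : ℕ → G.L2 := fun n => (hu n).memLp.toLp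
  let Y : ℕ → G.L2 := fun n => (hd n).toLp
  have hX : Tendsto X atTop (𝓝 f) := by
    have := (Lp.tendsto_Lp_iff_tendsto_eLpNorm'' (fun n => G.coord (u n)) (fun n => (hu n).memLp)
      f (Lp.memLp f)).2 hlim
    simpa using this
  have hYd : ∀ m n, dist (Y m) (Y n) = (eLpNorm (G.deriv₁ (u m - u n)) 2 G.vol).toReal :=
    fun m n => by
      rw [dist_edist, Lp.edist_toLp_toLp, (hu m).deriv₁_sub (hu n)]
  have hXd : ∀ m n, dist (X m) (X n) = (eLpNorm (G.coord (u m - u n)) 2 G.vol).toReal :=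
    fun m n => by
      rw [dist_edist, Lp.edist_toLp_toLp]
      rfl
  have hY : CauchySeq Y := by
    rw [cauchySeq_iff_tendsto_dist_atTop_0]
    simp only [hYd]
    simpa [Function.comp_def] using (ENNReal.tendsto_toReal ENNReal.zero_ne_top).comp hcau
  obtain ⟨g, hg⟩ := cauchySeq_tendsto_of_complete hY
  have hd' : ∀ m n, MemLp (G.deriv₁ (u m - u n)) 2 G.vol := fun m n => by
    rw [(hu m).deriv₁_sub (hu n)]
    exact (hd m).sub (hd n)
  obtain ⟨A, B, hAB⟩ := exists_abs_le (G := G) e₀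
  have hbound : ∀ m n x, |u m x - u n x| ≤ A * dist (X m) (X n) + B * dist (Y m) (Y n) :=
    fun m n x => by
      rw [hXd, hYd]
      exact hAB _ ((hu m).sub (hu n)) (hd' m n) x
  have hptw : ∀ x, ∃ y, Tendsto (fun n => u n x) atTop (𝓝 y) := fun x => by
    refine cauchySeq_tendsto_of_complete (cauchySeq_iff_tendsto_dist_atTop_0.2 ?_)
    have h1 := (cauchySeq_iff_tendsto_dist_atTop_0.1 hX.cauchySeq).const_mul A
    have h2 := (cauchySeq_iff_tendsto_dist_atTop_0.1 hY).const_mul B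
    have h3 := h1.add h2
    simp only [mul_zero, add_zero] at h3
    exact squeeze_zero (fun _ => dist_nonneg) (fun p => hbound p.1 p.2 x) h3
  choose U hU using hptw
  have hnorm : ∀ n, ‖Y n‖ = (eLpNorm (G.deriv₁ (u n)) 2 G.vol).toReal := fun n =>
    Lp.norm_toLp _ _
  -- The Hölder estimates of the `u n` pass to the pointwise limit with constant `‖g‖`.
  have hUu : UniformContinuous U := by
    refine uniformContinuous_of_abs_sub_le (M := ‖g‖) fun x y => ?_
    refine le_of_tendsto_of_tendsto' ((hU x).sub (hU y)).abs (hg.norm.mul_const _) fun n => ?_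
    rw [hnorm]
    exact abs_sub_le_eLpNorm_mul_sqrt (hu n) (hd n) x y
  have hgd : Tendsto (fun n => eLpNorm (G.deriv₁ (u n) - ⇑g) 2 G.vol) atTop (𝓝 0) := by
    refine (Lp.tendsto_Lp_iff_tendsto_eLpNorm'' (fun n => G.deriv₁ (u n)) hd g (Lp.memLp g)).1 ?_
    simpa using hg
  -- An almost everywhere convergent subsequence identifies the `L²` limit with the pointwise one.
  have hfU : f =ᵐ[G.vol] G.coord U := by
    obtain ⟨ns, hns, h⟩ := (tendstoInMeasure_of_tendsto_eLpNorm (by norm_num)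
      (fun n => (hu n).memLp.1) (Lp.memLp f).1 hlim).exists_seq_tendsto_ae
    filter_upwards [h] with p hp
    exact tendsto_nhds_unique hp ((hU _).comp hns.tendsto_atTop)
  have hint : ∀ e, ∀ s ∈ Icc 0 (G.len e),
      G.comp U e s - G.comp U e 0 = ∫ r in Ioc 0 s, g ⟨e, r⟩ := by
    intro e s hs
    have h1 := tendsto_setIntegral_of_L1' (fun s => g ⟨e, s⟩) (MemLp.slice (Lp.memLp g) e).1
      (F := fun n s => G.deriv₁ (u n) ⟨e, s⟩) (l := atTop)
      (Eventually.of_forall fun n => (MemLp.slice (hd n) e).integrable (by norm_num))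
      (tendsto_eLpNorm_one_slice (fun n => (hd n).1) (Lp.memLp g).1 hgd e) (Ioc 0 s)
    have hsub : Ioc 0 s ∩ Icc 0 (G.len e) = Ioc 0 s :=
      inter_eq_left.2 fun r hr => ⟨hr.1.le, hr.2.trans hs.2⟩
    rw [Measure.restrict_restrict measurableSet_Ioc, hsub] at h1
    refine tendsto_nhds_unique ((hU _).sub (hU _)) (h1.congr fun n => ?_)
    exact (hu n).integral_compDeriv hs
  obtain ⟨hF, hF'⟩ := isRegularRepresentative_extension hUu (Lp.memLp g) hint hfU
  refine ⟨_, hF, hgd.congr fun n => eLpNorm_congr_ae ?_⟩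
  filter_upwards [hF'] with p hp
  simp [hp]

/-- Two regular representatives have the same derivative. -/
lemma IsRegularRepresentative.deriv₁_eq [Countable Edge] {f : G.L2} {F F' : G.Completion → ℝ}
    (h : G.IsRegularRepresentative f F) (h' : G.IsRegularRepresentative f F') :
    G.deriv₁ (G.res F) = G.deriv₁ (G.res F') := by
  have hc : ∀ {F : G.Completion → ℝ}, Continuous F → Continuous (G.res F) := fun hF =>
    hF.comp (UniformSpace.Completion.continuous_coe _)
  have key : ∀ e, EqOn (G.comp (G.res F) e) (G.comp (G.res F') e) (Icc 0 (G.len e)) := fun e => by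
    have hae := G.ae_vol_iff.1 (h.ae_eq.symm.trans h'.ae_eq) e
    refine Measure.eqOn_Icc_of_ae_eq volume (G.len_pos e).ne ?_
      (continuous_comp (hc h.continuous) e).continuousOn
      (continuous_comp (hc h'.continuous) e).continuousOn
    exact hae
  ext ⟨e, s⟩
  by_cases hs : s ∈ Icc 0 (G.len e)
  · exact derivWithin_congr (key e) (key e hs)
  · simp [deriv₁, compDeriv_of_notMem hs]

end MetricGraph

/-! ### Calculus lemmas -/

/-- The derivative is locally constant on a connected interval, hence equal to one `m`; then `f r -
m * r` is constant inside, and by continuity up to the endpoints. -/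
lemma exists_slope_of_locally_affine {f : ℝ → ℝ} {a b : ℝ} (hab : a < b)
    (hc : ContinuousOn f (Icc a b))
    (h : ∀ s ∈ Ioo a b, ∃ m : ℝ, ∀ᶠ r in 𝓝 s, f r = f s + m * (r - s)) :
    ∃ m, ∀ r ∈ Icc a b, ∀ s ∈ Icc a b, f r - f s = m * (r - s) := by
  have hd : ∀ s ∈ Ioo a b, ∃ m, ∀ᶠ r in 𝓝 s, HasDerivAt f m r := by
    intro s hs
    obtain ⟨m, hm⟩ := h s hs
    refine ⟨m, hm.eventually_nhds.mono fun r hr => ?_⟩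
    have : HasDerivAt (fun r => f s + m * (r - s)) m r := by
      simpa using ((hasDerivAt_id r).sub_const s).const_mul m |>.const_add (f s)
    exact this.congr_of_eventuallyEq hr
  have hd' : ∀ s ∈ Ioo a b, HasDerivAt (deriv f) 0 s := by
    intro s hs
    obtain ⟨m, hm⟩ := hd s hs
    exact (hasDerivAt_const s m).congr_of_eventuallyEq (hm.mono fun r hr => hr.deriv)
  obtain ⟨m, hm⟩ := isOpen_Ioo.exists_is_const_of_deriv_eq_zero isPreconnected_Ioo
    (fun s hs => (hd' s hs).differentiableAt.differentiableWithinAt) (fun s hs => (hd' s hs).deriv)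
  have hfd : ∀ s ∈ Ioo a b, HasDerivAt f m s := fun s hs => by
    obtain ⟨m', hm'⟩ := hd s hs
    rw [← hm s hs, hm'.self_of_nhds.deriv]
    exact hm'.self_of_nhds
  have hg : ∀ s ∈ Ioo a b, HasDerivAt (fun r => f r - m * r) 0 s := fun s hs => by
    simpa using (hfd s hs).fun_sub ((hasDerivAt_id s).const_mul m)
  obtain ⟨c, hcst⟩ := isOpen_Ioo.exists_is_const_of_deriv_eq_zero isPreconnected_Ioo
    (fun s hs => (hg s hs).differentiableAt.differentiableWithinAt) (fun s hs => (hg s hs).deriv)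
  have key : EqOn (fun r => f r - m * r) (fun _ => c) (Icc a b) :=
    EqOn.of_subset_closure (s := Ioo a b) hcst (hc.sub (by fun_prop)) continuousOn_const
      Ioo_subset_Icc_self (closure_Ioo hab.ne).ge
  refine ⟨m, fun r hr s hs => ?_⟩
  have h1 := key hr
  have h2 := key hs
  simp only at h1 h2
  linarith

/-- A one-sided difference quotient in the direction of `m`. It bounds the derivative of a clamped
function without distinguishing where the clamp is active, and with `L = 0` it gives the sign of a
derivative at a first crossing. -/
lemma neg_mul_abs_le_mul_deriv {w : ℝ → ℝ} {w' m L s : ℝ} (hw : HasDerivAt w w' s)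
    (h : ∀ᶠ r in 𝓝 s, 0 ≤ m * (r - s) → w s - L * |r - s| ≤ w r) : -(L * |m|) ≤ m * w' := by
  have h1 : HasDerivAt (fun τ => w (s + m * τ)) (w' * m) 0 := by
    have h2 : HasDerivAt (fun τ => s + m * τ) m 0 := by
      simpa using ((hasDerivAt_id (0 : ℝ)).const_mul m).const_add s
    exact HasDerivAt.comp (h₂ := w) 0 (by simpa using hw) h2
  have h3 : Tendsto (fun τ : ℝ => s + m * τ) (𝓝[>] 0) (𝓝 s) := by
    have : Continuous fun τ : ℝ => s + m * τ := by fun_prop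
    simpa using (this.tendsto 0).mono_left nhdsWithin_le_nhds
  rw [mul_comm m]
  refine ge_of_tendsto h1.tendsto_slope_zero_right ?_
  filter_upwards [h3.eventually h, self_mem_nhdsWithin] with τ hτ hpos
  have hpos : 0 < τ := hpos
  have h4 := hτ (by
    rw [add_sub_cancel_left, ← mul_assoc]
    exact mul_nonneg (mul_self_nonneg m) hpos.le)
  rw [add_sub_cancel_left, abs_mul, abs_of_pos hpos] at h4
  rw [smul_eq_mul, inv_mul_eq_div, le_div_iff₀ hpos]
  simp only [zero_add, mul_zero, add_zero]
  linarith

/-- The projection onto `[0, 1]`. -/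
def clampUnit (a : ℝ) : ℝ := max 0 (min 1 a)

lemma clampUnit_mono : Monotone clampUnit := fun _ _ h => max_le_max le_rfl (min_le_min le_rfl h)

lemma continuous_clampUnit : Continuous clampUnit := by unfold clampUnit; fun_prop

lemma clampUnit_nonneg (a : ℝ) : 0 ≤ clampUnit a := le_max_left _ _

lemma clampUnit_le_one (a : ℝ) : clampUnit a ≤ 1 := max_le zero_le_one (min_le_left _ _)

lemma clampUnit_of_one_le {a : ℝ} (h : 1 ≤ a) : clampUnit a = 1 := by simp [clampUnit, h]

lemma clampUnit_of_nonpos {a : ℝ} (h : a ≤ 0) : clampUnit a = 0 := by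
  simp [clampUnit, h]

lemma abs_clampUnit_sub_le (a b : ℝ) : |clampUnit a - clampUnit b| ≤ |a - b| := by
  unfold clampUnit
  refine (abs_max_sub_max_le_max _ _ _ _).trans (max_le (by simp) ?_)
  exact (abs_min_sub_min_le_max _ _ _ _).trans (max_le (by simp) le_rfl)

namespace MetricGraph

variable {V Edge : Type*} {G : MetricGraph V Edge}

/-! ### Functions with a prescribed profile near the boundary -/

/-- Near the boundary of the completion, that is, in the set `U`, the function `φ` is locally of the
form `c * (κ + b)`, where `κ` is nonnegative, affine on the edges, and vanishes at the boundary. -/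
structure HasBoundaryProfile (φ κ : G.Point → ℝ) (U : Set G.Completion) : Prop where
  nonneg : ∀ x, 0 ≤ κ x
  continuousAt : ∀ x : G.Point, (x : G.Completion) ∈ U → ContinuousAt κ x
  locally_affine : ∀ e, ∀ s ∈ Ioo 0 (G.len e), (⟨e, s⟩ : Coord Edge) ∈ G.coordSet U →
    ∃ m : ℝ, ∀ᶠ r in 𝓝 s, G.comp κ e r = G.comp κ e s + m * (r - s)
  vanishes : ∀ t > 0, ∃ O, IsOpen O ∧ G.boundary ⊆ O ∧
    ∀ x : G.Point, (x : G.Completion) ∈ O → κ x < t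
  profile : ∀ x : G.Point, (x : G.Completion) ∈ U →
    ∃ c b, 0 ≤ b ∧ ∀ᶠ y in 𝓝 x, φ y = c * (κ y + b)

/-- A Lipschitz function with values in `[0, 1]` which is `1` on the boundary and supported in the
set `U`. -/
structure IsBoundaryBump (θ : G.Completion → ℝ) (L : NNReal) (U : Set G.Completion) : Prop where
  lipschitz : LipschitzWith L θ
  nonneg : ∀ x, 0 ≤ θ x
  le_one : ∀ x, θ x ≤ 1
  eq_one : ∀ x ∈ G.boundary, θ x = 1
  eventually_eq_zero : ∀ x ∉ U, ∀ᶠ y in 𝓝 x, θ y = 0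

/-- The bump lives on the `ε / 2`-neighborhood, whose closure is inside the `ε`-neighborhood; hence
it vanishes near each point outside, not only at it. -/
lemma exists_isBoundaryBump {ε : ℝ} (hε : 0 < ε) :
    ∃ θ L, G.IsBoundaryBump θ L (Metric.thickening ε G.boundary) := by
  have h2 := half_pos hε
  refine ⟨fun x => thickenedIndicator h2 G.boundary x, _,
    (LipschitzWith.subtype_val _).comp (lipschitzWith_thickenedIndicator h2 G.boundary),
    fun x => NNReal.coe_nonneg _, fun x => ?_, fun x hx => ?_, fun x hx => ?_⟩
  · exact_mod_cast thickenedIndicator_le_one h2 G.boundary x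
  · simp [thickenedIndicator_one h2 G.boundary hx]
  · have hx' : x ∉ closure (Metric.thickening (ε / 2) G.boundary) := fun h =>
      hx (Metric.cthickening_subset_thickening' hε (half_lt_self hε) _
        (Metric.closure_thickening_subset_cthickening _ _ h))
    filter_upwards [isClosed_closure.isOpen_compl.mem_nhds hx'] with y hy
    rw [thickenedIndicator_zero h2 G.boundary fun h => hy (subset_closure h)]
    rfl

/-- The cutoff function attached to `κ` and `θ`: it vanishes near the boundary, and increases to `1`
where `κ` is positive, as `t` tends to `0`. -/
def cutoff (κ : G.Point → ℝ) (θ : G.Completion → ℝ) (t : ℝ) (x : G.Point) : ℝ :=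
  clampUnit (κ x / t + 2 * (1 - θ x) - 1)

/-! ### Cutoff functions and the energy inequality -/

section Cutoff

variable {φ κ : G.Point → ℝ} {U : Set G.Completion} {θ : G.Completion → ℝ} {L : NNReal} {t : ℝ}

lemma cutoff_eq_one_of_eq_zero (hκ : ∀ x, 0 ≤ κ x) (ht : 0 < t) {x : G.Point}
    (hx : θ x = 0) : cutoff κ θ t x = 1 := by
  refine clampUnit_of_one_le ?_
  have : 0 ≤ κ x / t := div_nonneg (hκ x) ht.le
  rw [hx]
  linarith

lemma IsBoundaryBump.eventually_cutoff_eq_one (hθ : G.IsBoundaryBump θ L U) (hκ : ∀ x, 0 ≤ κ x)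
    (ht : 0 < t) {x : G.Point} (hx : (x : G.Completion) ∉ U) :
    ∀ᶠ y in 𝓝 x, cutoff κ θ t y = 1 :=
  ((UniformSpace.Completion.continuous_coe _).tendsto x |>.eventually
    (hθ.eventually_eq_zero _ hx)).mono fun _ hy => cutoff_eq_one_of_eq_zero hκ ht hy

lemma IsBoundaryBump.continuous_coe (hθ : G.IsBoundaryBump θ L U) :
    Continuous fun x : G.Point => θ x :=
  hθ.lipschitz.continuous.comp (UniformSpace.Completion.continuous_coe _)

/-- Nothing is known about continuity of `κ` outside `U`, but there the cutoff is locally the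
constant `1`. -/
lemma HasBoundaryProfile.continuous_cutoff (h : G.HasBoundaryProfile φ κ U)
    (hθ : G.IsBoundaryBump θ L U) (ht : 0 < t) : Continuous (cutoff κ θ t) := by
  refine continuous_iff_continuousAt.2 fun x => ?_
  by_cases hx : (x : G.Completion) ∈ U
  · refine continuous_clampUnit.continuousAt.comp ?_
    have h1 := hθ.continuous_coe.continuousAt (x := x)
    exact (((h.continuousAt x hx).div_const t).add
      ((continuousAt_const.sub h1).const_mul 2)).sub continuousAt_const
  · exact continuousAt_const.congr
      ((hθ.eventually_cutoff_eq_one h.nonneg ht hx).mono fun _ hy => hy.symm)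

lemma IsBoundaryBump.abs_sub_le (hθ : G.IsBoundaryBump θ L U) (e : Edge) (r s : ℝ) :
    |θ (G.onEdge e r) - θ (G.onEdge e s)| ≤ L * |r - s| := by
  have h1 := hθ.lipschitz.dist_le_mul (G.onEdge e r) (G.onEdge e s)
  have h2 := (lipschitzWith_onEdge (G := G) e).dist_le_mul r s
  rw [NNReal.coe_one, one_mul, Real.dist_eq] at h2
  rw [UniformSpace.Completion.dist_eq, Real.dist_eq] at h1
  exact h1.trans (by gcongr)

/-- On the compact edge it suffices to be locally Lipschitz: where the edge is in `U`, `κ` is affine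
and `θ` Lipschitz; elsewhere the cutoff is locally constant. -/
lemma HasBoundaryProfile.absolutelyContinuous_cutoff (h : G.HasBoundaryProfile φ κ U)
    (hU : IsOpen U) (hθ : G.IsBoundaryBump θ L U) (ht : 0 < t) (e : Edge) :
    AbsolutelyContinuousOnInterval (G.comp (cutoff κ θ t) e) 0 (G.len e) := by
  have hlen := G.len_pos e
  have hloc : LocallyLipschitzOn (Icc 0 (G.len e)) (G.comp (cutoff κ θ t) e) := by
    intro s hs
    by_cases hx : ((G.onEdge e s : G.Point) : G.Completion) ∈ U
    · obtain ⟨ρ, hρ, hball⟩ := Metric.isOpen_iff.1 (hU.preimage (continuous_coe_onEdge e)) s hx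
      -- The interval is clipped to the edge, as `s` may be an endpoint, where affineness comes only
      -- from continuity.
      set a := max 0 (s - ρ / 2)
      set b := min (G.len e) (s + ρ / 2)
      have hab : a < b := by
        have := hs.1
        have := hs.2
        simp only [a, b, max_lt_iff, lt_min_iff]
        refine ⟨⟨hlen, ?_⟩, ?_, ?_⟩ <;> linarith
      have hmem : ∀ r ∈ Icc a b, ((G.onEdge e r : G.Point) : G.Completion) ∈ U := fun r hr => by
        refine hball ?_
        have h1 := (le_max_right _ _).trans hr.1
        have h2 := hr.2.trans (min_le_right _ _)
        rw [Metric.mem_ball, Real.dist_eq, abs_lt]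
        constructor <;> linarith
      obtain ⟨m, hm⟩ := exists_slope_of_locally_affine (f := G.comp κ e) hab
        (fun r hr => ((h.continuousAt _ (hmem r hr)).comp
          (continuous_onEdge e).continuousAt).continuousWithinAt)
        (fun r hr => h.locally_affine e r ⟨(le_max_left _ _).trans_lt hr.1,
          hr.2.trans_le (min_le_left _ _)⟩ (hmem r (Ioo_subset_Icc_self hr)))
      refine ⟨(|m| / t + 2 * L).toNNReal, Icc a b, ?_, LipschitzOnWith.of_dist_le_mul ?_⟩
      · have : Icc (s - ρ / 2) (s + ρ / 2) ∈ 𝓝 s := Icc_mem_nhds (by linarith) (by linarith)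
        refine mem_of_superset (inter_mem_nhdsWithin _ this) fun r hr => ?_
        exact ⟨max_le hr.1.1 hr.2.1, le_min hr.1.2 hr.2.2⟩
      · intro r hr r' hr'
        rw [Real.coe_toNNReal _ (by positivity), Real.dist_eq, Real.dist_eq]
        refine (abs_clampUnit_sub_le _ _).trans ?_
        have h1 := hm r hr r' hr'
        have h2 := hθ.abs_sub_le e r r'
        have h3 : κ (G.onEdge e r) / t + 2 * (1 - θ (G.onEdge e r)) - 1 -
            (κ (G.onEdge e r') / t + 2 * (1 - θ (G.onEdge e r')) - 1) =
            m * (r - r') / t - 2 * (θ (G.onEdge e r) - θ (G.onEdge e r')) := by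
          rw [← h1]
          simp only [comp]
          ring
        rw [h3]
        refine (abs_sub _ _).trans ?_
        rw [abs_div, abs_mul, abs_mul, abs_of_pos ht, abs_two, add_mul]
        refine add_le_add (le_of_eq (by ring)) ?_
        linarith
    · have h1 := (continuous_onEdge e).tendsto s |>.eventually
        (hθ.eventually_cutoff_eq_one h.nonneg ht hx)
      refine ⟨0, {r | cutoff κ θ t (G.onEdge e r) = 1}, nhdsWithin_le_nhds h1, ?_⟩
      refine LipschitzOnWith.of_dist_le_mul fun r hr r' hr' => ?_
      simp only [mem_ofPred_eq] at hr hr'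
      simp [comp, hr, hr']
  obtain ⟨K, hK⟩ := hloc.exists_lipschitzOnWith_of_compact isCompact_Icc
  exact LipschitzOnWith.absolutelyContinuousOnInterval (K := K)
    (by rwa [uIcc_of_le hlen.le])

/-- In the interior of an edge near the boundary, a function with a boundary profile is affine. -/
lemma HasBoundaryProfile.exists_hasDerivAt (h : G.HasBoundaryProfile φ κ U) {e : Edge} {s : ℝ}
    (hs : s ∈ Ioo 0 (G.len e)) (hU : (⟨e, s⟩ : Coord Edge) ∈ G.coordSet U) :
    ∃ c b m, 0 ≤ b ∧ G.comp φ e s = c * (G.comp κ e s + b) ∧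
      (∀ᶠ r in 𝓝 s, G.comp κ e r = G.comp κ e s + m * (r - s)) ∧
      ∀ᶠ r in 𝓝 s, HasDerivAt (G.comp φ e) (c * m) r := by
  obtain ⟨c, b, hb, hφ⟩ := h.profile (G.onEdge e s) hU
  obtain ⟨m, hm⟩ := h.locally_affine e s hs hU
  have hφ' : ∀ᶠ r in 𝓝 s, G.comp φ e r = c * (G.comp κ e r + b) :=
    (continuous_onEdge e).tendsto s |>.eventually hφ
  refine ⟨c, b, m, hb, hφ'.self_of_nhds, hm, ?_⟩
  have h1 : ∀ᶠ r in 𝓝 s, G.comp φ e r = c * (G.comp κ e s + m * (r - s) + b) := by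
    filter_upwards [hφ', hm] with r h1 h2
    rw [h1, h2]
  refine h1.eventually_nhds.mono fun r hr => ?_
  have h2 : HasDerivAt (fun r => c * (G.comp κ e s + m * (r - s) + b)) (c * m) r := by
    have := ((((hasDerivAt_id r).sub_const s).const_mul m).const_add (G.comp κ e s)).add_const b
      |>.const_mul c
    simpa using this
  exact h2.congr_of_eventuallyEq hr

lemma HasBoundaryProfile.deriv₂_eq_zero (h : G.HasBoundaryProfile φ κ U) {e : Edge} {s : ℝ}
    (hs : s ∈ Ioo 0 (G.len e)) (hU : (⟨e, s⟩ : Coord Edge) ∈ G.coordSet U) :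
    G.deriv₂ φ ⟨e, s⟩ = 0 := by
  obtain ⟨c, b, m, -, -, -, hd⟩ := h.exists_hasDerivAt hs hU
  rw [deriv₂_eq_deriv hs]
  have h1 : G.compDeriv φ e =ᶠ[𝓝 s] fun _ => c * m := by
    filter_upwards [hd, isOpen_Ioo.mem_nhds hs] with r hr hrs
    rw [compDeriv_eq_deriv hrs, hr.deriv]
  rw [h1.deriv_eq, deriv_const]

/-- Where `κ` vanishes near the boundary, the derivative of the function vanishes. -/
lemma HasBoundaryProfile.compDeriv_eq_zero (h : G.HasBoundaryProfile φ κ U) {e : Edge} {s : ℝ}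
    (hs : s ∈ Ioo 0 (G.len e)) (hU : (⟨e, s⟩ : Coord Edge) ∈ G.coordSet U)
    (h0 : G.comp κ e s = 0) : G.compDeriv φ e s = 0 := by
  obtain ⟨c, b, m, -, -, hm, hd⟩ := h.exists_hasDerivAt hs hU
  have h1 : HasDerivAt (G.comp κ e) m s := by
    have h2 : HasDerivAt (fun r => G.comp κ e s + m * (r - s)) m s := by
      simpa using (((hasDerivAt_id s).sub_const s).const_mul m).const_add (G.comp κ e s)
    exact h2.congr_of_eventuallyEq hm
  have h3 : IsLocalMin (G.comp κ e) s := Eventually.of_forall fun r => by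
    rw [h0]
    exact h.nonneg _
  -- A zero of the nonnegative `κ` is a minimum, so its slope `m` is `0`.
  rw [compDeriv_eq_deriv hs, hd.self_of_nhds.deriv, h3.hasDerivAt_eq_zero h1, mul_zero]

lemma IsBoundaryBump.mem_of_cutoff_lt (hθ : G.IsBoundaryBump θ L U) (hκ : ∀ x, 0 ≤ κ x)
    (ht : 0 < t) {x : G.Point} (hx : cutoff κ θ t x < 1) : (x : G.Completion) ∈ U := by
  by_contra hU
  exact hx.ne (hθ.eventually_cutoff_eq_one hκ ht hU).self_of_nhds

/-- The cutoff does not decrease the energy by more than a small error term. -/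
lemma HasBoundaryProfile.le_mul_deriv_cutoff (h : G.HasBoundaryProfile φ κ U)
    (hθ : G.IsBoundaryBump θ L U) (ht : 0 < t) {e : Edge} {s : ℝ} (hs : s ∈ Ioo 0 (G.len e))
    (hd : DifferentiableAt ℝ (G.comp (cutoff κ θ t) e) s) (hlt : cutoff κ θ t (G.onEdge e s) < 1) :
    -(2 * L * |G.comp φ e s * G.compDeriv φ e s|) ≤
      G.comp φ e s * G.compDeriv φ e s * deriv (G.comp (cutoff κ θ t) e) s := by
  have hU := hθ.mem_of_cutoff_lt h.nonneg ht hlt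
  obtain ⟨c, b, m, hb, hφ, hm, hφd⟩ := h.exists_hasDerivAt hs hU
  -- In the direction of `m` the function `κ` does not decrease, so only `2 * (1 - θ)` can lower the
  -- cutoff, at a rate of at most `2 * L`.
  have key : -(2 * L * |m|) ≤ m * deriv (G.comp (cutoff κ θ t) e) s := by
    refine neg_mul_abs_le_mul_deriv hd.hasDerivAt ?_
    filter_upwards [hm] with r hr hmr
    have h1 := hθ.abs_sub_le e r s
    have h2 : κ (G.onEdge e s) / t ≤ κ (G.onEdge e r) / t := by
      have : κ (G.onEdge e r) = κ (G.onEdge e s) + m * (r - s) := hr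
      gcongr
      linarith
    have h3 : clampUnit (κ (G.onEdge e s) / t + 2 * (1 - θ (G.onEdge e s)) - 1 - 2 * L * |r - s|) ≤
        G.comp (cutoff κ θ t) e r := by
      refine clampUnit_mono ?_
      linarith [le_abs_self (θ (G.onEdge e r) - θ (G.onEdge e s))]
    have h4 := abs_clampUnit_sub_le (κ (G.onEdge e s) / t + 2 * (1 - θ (G.onEdge e s)) - 1)
      (κ (G.onEdge e s) / t + 2 * (1 - θ (G.onEdge e s)) - 1 - 2 * L * |r - s|)
    rw [sub_sub_cancel, abs_of_nonneg (by positivity : (0 : ℝ) ≤ 2 * L * |r - s|)] at h4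
    have h5 : G.comp (cutoff κ θ t) e s =
      clampUnit (κ (G.onEdge e s) / t + 2 * (1 - θ (G.onEdge e s)) - 1) := rfl
    linarith [le_abs_self (clampUnit (κ (G.onEdge e s) / t + 2 * (1 - θ (G.onEdge e s)) - 1) -
      clampUnit (κ (G.onEdge e s) / t + 2 * (1 - θ (G.onEdge e s)) - 1 - 2 * L * |r - s|))]
  rw [compDeriv_eq_deriv hs, hφd.self_of_nhds.deriv, hφ]
  -- The sign of `b` matters here: `φ φ'` is a nonnegative multiple of the slope `m`.
  have hκb : 0 ≤ c ^ 2 * (G.comp κ e s + b) :=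
    mul_nonneg (sq_nonneg c) (add_nonneg (h.nonneg _) hb)
  have e1 : c * (G.comp κ e s + b) * (c * m) = c ^ 2 * (G.comp κ e s + b) * m := by ring
  rw [e1, abs_mul, abs_of_nonneg hκb]
  calc _ = c ^ 2 * (G.comp κ e s + b) * -(2 * L * |m|) := by ring
    _ ≤ c ^ 2 * (G.comp κ e s + b) * (m * deriv (G.comp (cutoff κ θ t) e) s) := by gcongr
    _ = _ := by ring

/-- The value `1` is a maximum of the cutoff; `deriv` is `0` there even if the cutoff is not
differentiable. -/
lemma deriv_cutoff_eq_zero {e : Edge} {s : ℝ} (h1 : cutoff κ θ t (G.onEdge e s) = 1) :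
    deriv (G.comp (cutoff κ θ t) e) s = 0 := by
  have : IsLocalMax (G.comp (cutoff κ θ t) e) s := Eventually.of_forall fun r => by
    change cutoff κ θ t (G.onEdge e r) ≤ cutoff κ θ t (G.onEdge e s)
    rw [h1]
    exact clampUnit_le_one _
  exact this.deriv_eq_zero

/-- Where `κ < t / 2` and `θ > 3 / 4`, the argument of the clamp is below `1 / 2 + 1 / 2 - 1 = 0`.
-/
lemma HasBoundaryProfile.exists_cutoff_eq_zero (h : G.HasBoundaryProfile φ κ U)
    (hθ : G.IsBoundaryBump θ L U) (ht : 0 < t) :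
    ∃ O, IsOpen O ∧ G.boundary ⊆ O ∧ ∀ x : G.Point, (x : G.Completion) ∈ O →
      cutoff κ θ t x = 0 := by
  obtain ⟨O, hO, hb, hκ⟩ := h.vanishes (t / 2) (half_pos ht)
  refine ⟨O ∩ θ ⁻¹' Ioi (3 / 4), hO.inter (isOpen_Ioi.preimage hθ.lipschitz.continuous),
    fun x hx => ⟨hb hx, ?_⟩, fun x hx => clampUnit_of_nonpos ?_⟩
  · rw [mem_preimage, hθ.eq_one x hx, mem_Ioi]
    norm_num
  · have h1 : κ x / t ≤ 1 / 2 := by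
      rw [div_le_iff₀ ht]
      linarith [hκ x hx.1]
    have h2 : 3 / 4 < θ x := hx.2
    linarith

lemma comp_mul (f g : G.Point → ℝ) (e : Edge) : G.comp (f * g) e = G.comp f e * G.comp g e := rfl

lemma ae_deriv₁_mul [Countable Edge] {w : G.Point → ℝ} (hφ : G.MemDmax φ)
    (hw : ∀ e, AbsolutelyContinuousOnInterval (G.comp w e) 0 (G.len e)) :
    ∀ᵐ p ∂G.vol, p.2 ∈ Ioo 0 (G.len p.1) ∧ DifferentiableAt ℝ (G.comp w p.1) p.2 ∧
      G.deriv₁ (φ * w) p = G.deriv₁ φ p * G.coord w p + G.coord φ p * deriv (G.comp w p.1) p.2 := by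
  refine ae_vol_of_Ioo fun e => ?_
  filter_upwards [(hw e).ae_differentiableAt] with s h hs
  have h1 := h (by rw [uIcc_of_le (G.len_pos e).le]; exact Ioo_subset_Icc_self hs)
  refine ⟨hs, h1, ?_⟩
  rw [deriv₁, deriv₁, compDeriv_eq_deriv hs, comp_mul]
  exact ((hφ.hasDerivAt hs).mul h1.hasDerivAt).deriv

/-- The form of `-D²` in terms of the cutoff. -/
lemma HasBoundaryProfile.form_eq [Countable Edge] [CompactSpace G.Completion]
    (h : G.HasBoundaryProfile φ κ U) (hU : IsOpen U) (hθ : G.IsBoundaryBump θ L U) (ht : 0 < t)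
    (hφ : G.MemDmax φ) :
    Integrable (fun p => G.deriv₁ φ p * G.deriv₁ (φ * cutoff κ θ t) p) G.vol ∧
    G.form φ φ = ∫ p, G.deriv₁ φ p * G.deriv₁ (φ * cutoff κ θ t) p ∂G.vol := by
  have hw := h.absolutelyContinuous_cutoff hU hθ ht
  obtain ⟨O, hO, hb, h0⟩ := h.exists_cutoff_eq_zero hθ ht
  have hac : ∀ e, AbsolutelyContinuousOnInterval (G.comp (φ * cutoff κ θ t) e) 0 (G.len e) :=
    fun e => (hφ.absolutelyContinuous e).mul (hw e)
  have h0' : ∀ x : G.Point, (x : G.Completion) ∈ O → (φ * cutoff κ θ t) x = 0 := fun x hx => by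
    simp [h0 x hx]
  refine ⟨integrable_deriv₁_mul_deriv₁ hφ hac hO hb h0', ?_⟩
  rw [← integral_neg_deriv₂_mul hφ (hφ.continuous.mul (h.continuous_cutoff hθ ht)) hac hO hb h0']
  refine integral_congr_ae (ae_vol_of_Ioo fun e => ae_of_all _ fun s hs => ?_)
  -- Inserting the cutoff changes nothing: `φ'' = 0` in `U`, and the cutoff is `1` outside.
  by_cases hU' : (⟨e, s⟩ : Coord Edge) ∈ G.coordSet U
  · simp [h.deriv₂_eq_zero hs hU']
  · have h1 : cutoff κ θ t (G.onEdge e s) = 1 :=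
      (hθ.eventually_cutoff_eq_one h.nonneg ht hU').self_of_nhds
    simp [coord, comp, h1]

lemma coord_cutoff_nonneg (p : Coord Edge) : 0 ≤ G.coord (cutoff κ θ t) p := clampUnit_nonneg _

lemma coord_cutoff_le_one (p : Coord Edge) : G.coord (cutoff κ θ t) p ≤ 1 := clampUnit_le_one _

/-- The energy density after the cutoff, with the error term of the cutoff. -/
def cutoffDensity (φ κ : G.Point → ℝ) (θ : G.Completion → ℝ) (L : NNReal) (t : ℝ)
    (p : Coord Edge) : ℝ :=
  G.deriv₁ φ p ^ 2 * G.coord (cutoff κ θ t) p -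
    {p | G.coord (cutoff κ θ t) p < 1}.indicator
      (fun p => 2 * L * |G.coord φ p * G.deriv₁ φ p|) p

lemma cutoffDensity_of_lt {p : Coord Edge} (hp : G.coord (cutoff κ θ t) p < 1) :
    cutoffDensity φ κ θ L t p = G.deriv₁ φ p ^ 2 * G.coord (cutoff κ θ t) p -
      2 * L * |G.coord φ p * G.deriv₁ φ p| := by
  rw [cutoffDensity, indicator_of_mem (by exact hp)]

lemma cutoffDensity_of_eq {p : Coord Edge} (hp : G.coord (cutoff κ θ t) p = 1) :
    cutoffDensity φ κ θ L t p = G.deriv₁ φ p ^ 2 := by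
  rw [cutoffDensity, indicator_of_notMem (by exact hp.not_lt), hp, mul_one, sub_zero]

/-- The bound does not depend on `t`; it is the majorant for letting `t → 0`. -/
lemma norm_cutoffDensity_le (p : Coord Edge) : ‖cutoffDensity φ κ θ L t p‖ ≤
    G.deriv₁ φ p ^ 2 + 2 * L * |G.coord φ p * G.deriv₁ φ p| := by
  have h0 : 0 ≤ 2 * L * |G.coord φ p * G.deriv₁ φ p| := by positivity
  have h1 := sq_nonneg (G.deriv₁ φ p)
  rcases (coord_cutoff_le_one (κ := κ) (θ := θ) (t := t) p).lt_or_eq with hp | hp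
  · rw [cutoffDensity_of_lt hp]
    refine (norm_sub_le _ _).trans ?_
    rw [Real.norm_of_nonneg h0, Real.norm_of_nonneg (mul_nonneg h1 (coord_cutoff_nonneg p))]
    gcongr
    exact mul_le_of_le_one_right h1 hp.le
  · rw [cutoffDensity_of_eq hp, Real.norm_of_nonneg h1]
    linarith

lemma HasBoundaryProfile.integrable_cutoffDensity (h : G.HasBoundaryProfile φ κ U)
    (hθ : G.IsBoundaryBump θ L U) (ht : 0 < t)
    (hsq : Integrable (fun p => G.deriv₁ φ p ^ 2) G.vol)
    (hcr : Integrable (fun p => 2 * L * |G.coord φ p * G.deriv₁ φ p|) G.vol) :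
    Integrable (cutoffDensity φ κ θ L t) G.vol := by
  have hm := measurable_coord (h.continuous_cutoff hθ ht)
  refine Integrable.sub (hsq.mul_bdd (c := 1) hm.aestronglyMeasurable (ae_of_all _ fun p => ?_))
    (hcr.indicator (measurableSet_lt hm measurable_const))
  rw [Real.norm_of_nonneg (coord_cutoff_nonneg p)]
  exact coord_cutoff_le_one p

lemma HasBoundaryProfile.integral_cutoffDensity_le [Countable Edge] [CompactSpace G.Completion]
    (h : G.HasBoundaryProfile φ κ U) (hU : IsOpen U) (hθ : G.IsBoundaryBump θ L U) (ht : 0 < t)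
    (hφ : G.MemDmax φ) (hi : Integrable (cutoffDensity φ κ θ L t) G.vol) :
    ∫ p, cutoffDensity φ κ θ L t p ∂G.vol ≤ G.form φ φ := by
  obtain ⟨hi', he⟩ := h.form_eq hU hθ ht hφ
  rw [he]
  refine integral_mono_ae hi hi' ?_
  filter_upwards [ae_deriv₁_mul hφ (h.absolutelyContinuous_cutoff hU hθ ht)]
    with ⟨e, s⟩ ⟨hs, hd, hp⟩
  rw [hp]
  rcases (coord_cutoff_le_one (G := G) (κ := κ) (θ := θ) (t := t) ⟨e, s⟩).lt_or_eq with h1 | h1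
  · have := h.le_mul_deriv_cutoff hθ ht hs hd h1
    rw [cutoffDensity_of_lt h1]
    change -(2 * L * |G.coord φ ⟨e, s⟩ * G.deriv₁ φ ⟨e, s⟩|) ≤
      G.coord φ ⟨e, s⟩ * G.deriv₁ φ ⟨e, s⟩ * _ at this
    linarith
  · rw [cutoffDensity_of_eq h1, deriv_cutoff_eq_zero h1, h1]
    apply le_of_eq
    ring

/-- The energy is bounded by the form of `-D²`. -/
theorem HasBoundaryProfile.integral_sq_le_form [Countable Edge] [CompactSpace G.Completion]
    (h : G.HasBoundaryProfile φ κ U) (hU : IsOpen U) (hθ : G.IsBoundaryBump θ L U)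
    (hφ : G.MemDmax φ) (hφ' : MemLp (G.deriv₁ φ) 2 G.vol) :
    ∫ p, G.deriv₁ φ p ^ 2 ∂G.vol ≤ G.form φ φ := by
  let t : ℕ → ℝ := fun n => 1 / ((n : ℝ) + 1)
  have ht : ∀ n, 0 < t n := fun n => by positivity
  have ht0 : Tendsto t atTop (𝓝[>] 0) :=
    tendsto_nhdsWithin_iff.2 ⟨tendsto_one_div_add_atTop_nhds_zero_nat, Eventually.of_forall ht⟩
  have hsq : Integrable (fun p => G.deriv₁ φ p ^ 2) G.vol :=
    (memLp_two_iff_integrable_sq hφ'.1).1 hφ'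
  have hcr : Integrable (fun p => 2 * L * |G.coord φ p * G.deriv₁ φ p|) G.vol :=
    (hφ.memLp.integrable_mul hφ').abs.const_mul _
  have hi : ∀ n, Integrable (cutoffDensity φ κ θ L (t n)) G.vol := fun n =>
    h.integrable_cutoffDensity hθ (ht n) hsq hcr
  refine le_of_tendsto' (tendsto_integral_of_dominated_convergence _
    (fun n => (hi n).1) (hsq.add hcr) (fun n => ae_of_all _ norm_cutoffDensity_le) ?_)
    fun n => h.integral_cutoffDensity_le hU hθ (ht n) hφ (hi n)
  refine ae_vol_of_Ioo fun e => ae_of_all _ fun s hs => ?_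
  -- The error term survives only where `κ = 0` in `U`, and there the derivative vanishes. Where `κ
  -- > 0`, the quotient `κ / t` reaches `2`, which makes up for the `-1` in the cutoff.
  have hcase : G.deriv₁ φ ⟨e, s⟩ = 0 ∨ ∀ᶠ n in atTop, G.coord (cutoff κ θ (t n)) ⟨e, s⟩ = 1 := by
    by_cases hU' : (⟨e, s⟩ : Coord Edge) ∈ G.coordSet U
    · rcases (h.nonneg (G.onEdge e s)).eq_or_lt with h0 | h0
      · exact Or.inl (h.compDeriv_eq_zero hs hU' h0.symm)
      · right
        have h1 : Tendsto (fun n => κ (G.onEdge e s) / t n) atTop atTop := by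
          simp only [div_eq_mul_inv]
          exact (tendsto_inv_nhdsGT_zero.comp ht0).const_mul_atTop h0
        filter_upwards [h1.eventually_ge_atTop 2] with n hn
        refine clampUnit_of_one_le ?_
        linarith [hθ.le_one (G.onEdge e s)]
    · exact Or.inr (Eventually.of_forall fun n =>
        (hθ.eventually_cutoff_eq_one h.nonneg (ht n) hU').self_of_nhds)
  rcases hcase with h0 | h1
  · have : ∀ n, cutoffDensity φ κ θ L (t n) ⟨e, s⟩ = 0 := fun n => by
      have := norm_cutoffDensity_le (φ := φ) (κ := κ) (θ := θ) (L := L) (t := t n) ⟨e, s⟩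
      simpa [h0] using this
    simp [this, h0]
  · refine tendsto_const_nhds.congr' ?_
    filter_upwards [h1] with n hn
    rw [cutoffDensity_of_eq hn]

/-- If the function is locally constant near the boundary, then its energy is the form of `-D²`. -/
theorem HasBoundaryProfile.form_eq_integral_sq [Countable Edge] [CompactSpace G.Completion]
    (h : G.HasBoundaryProfile φ (fun _ => 0) U) (hU : IsOpen U) (hθ : G.IsBoundaryBump θ L U)
    (hφ : G.MemDmax φ) :
    MemLp (G.deriv₁ φ) 2 G.vol ∧ G.form φ φ = ∫ p, G.deriv₁ φ p ^ 2 ∂G.vol := by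
  obtain ⟨hi, he⟩ := h.form_eq hU hθ one_pos hφ
  have hae : (fun p => G.deriv₁ φ p * G.deriv₁ (φ * cutoff (fun _ => 0) θ 1) p) =ᵐ[G.vol]
      fun p => G.deriv₁ φ p ^ 2 := by
    filter_upwards [ae_deriv₁_mul hφ (h.absolutelyContinuous_cutoff hU hθ one_pos)]
      with ⟨e, s⟩ ⟨hs, _, hp⟩
    by_cases hU' : (⟨e, s⟩ : Coord Edge) ∈ G.coordSet U
    · have : G.deriv₁ φ ⟨e, s⟩ = 0 := h.compDeriv_eq_zero hs hU' rfl
      simp [this]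
    · have h1 : cutoff (fun _ => 0) θ 1 (G.onEdge e s) = 1 :=
        (hθ.eventually_cutoff_eq_one h.nonneg one_pos hU').self_of_nhds
      rw [hp, deriv_cutoff_eq_zero h1]
      simp only [coord, comp, h1]
      ring
  exact ⟨(memLp_two_iff_integrable_sq hφ.aestronglyMeasurable_deriv₁).2 (hi.congr hae),
    he.trans (integral_congr_ae hae)⟩

end Cutoff

/-! ### Functions with positive outward derivative on level sets -/

/-- The trace of the path, one edge segment at a time. -/
lemma Path.exists_isPreconnected {x y : G.Point} {L : ℝ} (h : G.Path x y L) :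
    ∃ S : Set G.Completion, IsPreconnected S ∧ (x : G.Completion) ∈ S ∧ (y : G.Completion) ∈ S ∧
      S ⊆ Metric.closedBall (x : G.Completion) L := by
  induction h with
  | refl => exact ⟨{(x : G.Completion)}, isPreconnected_singleton, rfl, rfl, by simp⟩
  | @tail y z L c hp hs ih =>
    obtain ⟨S, hS, hx, hy, hsub⟩ := ih
    have of_zero : G.Step y z 0 → ∃ S : Set G.Completion, IsPreconnected S ∧
        (x : G.Completion) ∈ S ∧ (z : G.Completion) ∈ S ∧
        S ⊆ Metric.closedBall (x : G.Completion) (L + 0) := fun h =>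
      ⟨S, hS, hx, coe_eq_coe_of_step h ▸ hy, by simpa using hsub⟩
    cases hs with
    | along e s t =>
      refine ⟨S ∪ (fun r => ((G.onEdge e r : G.Point) : G.Completion)) '' uIcc (s : ℝ) t,
        IsPreconnected.union ((G.onEdge e s : G.Point) : G.Completion) ?_ ?_ hS
          (isPreconnected_uIcc.image _ (continuous_coe_onEdge e).continuousOn), Or.inl hx,
        Or.inr ⟨t, right_mem_uIcc, by simp only [onEdge_coe]⟩, union_subset ?_ ?_⟩
      · rwa [onEdge_coe]
      · exact ⟨s, left_mem_uIcc, rfl⟩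
      · exact hsub.trans (Metric.closedBall_subset_closedBall (by simp))
      · rintro _ ⟨r, hr, rfl⟩
        have h1 : dist (G.onEdge e s) x ≤ L := by
          rw [← onEdge_coe] at hy
          simpa using hsub hy
        have h2 := (lipschitzWith_onEdge (G := G) e).dist_le_mul r s
        rw [NNReal.coe_one, one_mul, Real.dist_eq] at h2
        have h3 := abs_sub_left_of_mem_uIcc hr
        rw [Metric.mem_closedBall, UniformSpace.Completion.dist_eq]
        have h4 := dist_triangle (G.onEdge e r) (G.onEdge e s) x
        linarith
    | leaveSrc e => exact of_zero (Step.leaveSrc e)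
    | enterSrc e => exact of_zero (Step.enterSrc e)
    | leaveTgt e => exact of_zero (Step.leaveTgt e)
    | enterTgt e => exact of_zero (Step.enterTgt e)

/-- Points of the graph near a point of the completion are connected to it nearby. -/
lemma exists_isPreconnected_subset_ball {p : G.Completion} {r : ℝ} {x : G.Point}
    (hx : dist (x : G.Completion) p < r / 3) :
    ∃ S ⊆ Metric.ball p r, IsPreconnected S ∧ p ∈ S ∧ (x : G.Completion) ∈ S := by
  have hr : 0 < r / 3 := dist_nonneg.trans_lt hx
  have h1 : ∀ z : G.Point, dist (z : G.Completion) p < r / 3 → ∃ S ⊆ Metric.ball p r,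
      IsPreconnected S ∧ (x : G.Completion) ∈ S ∧ (z : G.Completion) ∈ S := by
    intro z hz
    -- A path shorter than `2 * r / 3` from `x`, which is within `r / 3` of `p`, stays in the ball
    -- of radius `r`.
    have h2 : dist x z < 2 * r / 3 := by
      rw [← UniformSpace.Completion.dist_eq]
      have := dist_triangle_right (x : G.Completion) z p
      linarith
    obtain ⟨L, hL, hp⟩ := exists_path_lt h2
    obtain ⟨S, hS, hxS, hzS, hsub⟩ := hp.exists_isPreconnected
    refine ⟨S, fun q hq => ?_, hS, hxS, hzS⟩
    have h3 := hsub hq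
    rw [Metric.mem_closedBall] at h3
    rw [Metric.mem_ball]
    have := dist_triangle q (x : G.Completion) p
    linarith
  -- The point `p` may lie outside the graph and be the end of no path. It is a limit of graph
  -- points connected to `x` in the ball, and adding a limit point keeps the union of these sets
  -- connected.
  let c : Set (Set G.Completion) :=
    {S | S ⊆ Metric.ball p r ∧ IsPreconnected S ∧ (x : G.Completion) ∈ S}
  have hc : IsPreconnected (⋃₀ c) :=
    isPreconnected_sUnion (x : G.Completion) c (fun S hS => hS.2.2) fun S hS => hS.2.1
  have hpc : p ∈ closure (⋃₀ c) := by
    refine Metric.mem_closure_iff.2 fun ε hε => ?_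
    obtain ⟨_, ⟨z, rfl⟩, hz⟩ := Metric.mem_closure_iff.1
      (UniformSpace.Completion.denseRange_coe (α := G.Point) p) (min ε (r / 3)) (lt_min hε hr)
    rw [dist_comm] at hz
    obtain ⟨S, h2, h3, h4, h5⟩ := h1 z (hz.trans_le (min_le_right _ _))
    exact ⟨z, ⟨S, ⟨h2, h3, h4⟩, h5⟩, by rw [dist_comm]; exact hz.trans_le (min_le_left _ _)⟩
  obtain ⟨S, h2, h3, h4, -⟩ := h1 x hx
  refine ⟨insert p (⋃₀ c), insert_subset ?_ (sUnion_subset fun S hS => hS.1),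
    hc.subset_closure (subset_insert _ _) (insert_subset hpc subset_closure), mem_insert _ _,
    Or.inr ⟨S, ⟨h2, h3, h4⟩, h4⟩⟩
  rw [Metric.mem_ball, dist_self]
  linarith

/-- The point `q` is connected to `A` within the part of the `ρ`-neighborhood of `A` where
`k > t`. -/
def ConnectedAbove (A : Set G.Completion) (ρ : ℝ) (k : G.Completion → ℝ) (t : ℝ)
    (q : G.Completion) : Prop :=
  ∃ P ⊆ Metric.thickening ρ A ∩ {y | t < k y}, IsPreconnected P ∧ (P ∩ A).Nonempty ∧ q ∈ P

section

variable {A : Set G.Completion} {ρ η C t : ℝ} {k : G.Completion → ℝ}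

/-- If `k` has positive outward derivative on the level set `{k = t}`, then one does not cross this
level set along an edge, starting from the part where `k > t`. -/
lemma ConnectedAbove.lt_along (hρη : ρ ≤ η) (hk : ContinuousOn k (Metric.thickening ρ A))
    (htV : ∀ v : V, k (G.vertex v) ≠ t)
    (hout : ∀ e, ∀ s ∈ Ioo 0 (G.len e), G.comp (G.res k) e s = t →
      (⟨e, s⟩ : Coord Edge) ∈ G.coordSet (Metric.thickening η A) →
      ∀ σ : ℝ, σ = 1 ∨ σ = -1 → G.PointsAwayFrom A η k e s σ →
        0 < σ * deriv (G.comp (G.res k) e) s)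
    {e : Edge} {s c σ : ℝ} (hs : s ∈ Icc 0 (G.len e))
    (hsc : s + σ * c ∈ Icc 0 (G.len e)) (hσ : σ = 1 ∨ σ = -1)
    (hA : ConnectedAbove A ρ k t (G.onEdge e s : G.Point))
    (hmem : ∀ v ∈ Icc 0 c, ((G.onEdge e (s + σ * v) : G.Point) : G.Completion) ∈
      Metric.thickening ρ A) :
    ∀ v ∈ Icc 0 c, t < k (G.onEdge e (s + σ * v)) := by
  by_contra! hcon
  obtain ⟨v₀, hv₀, hle₀⟩ := hcon
  have hline : Continuous fun v : ℝ => s + σ * v := by fun_prop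
  let γ : ℝ → G.Completion := fun v => ((G.onEdge e (s + σ * v) : G.Point) : G.Completion)
  have hγ : Continuous γ := (continuous_coe_onEdge e).comp hline
  have hg : ContinuousOn (fun v => k (γ v)) (Icc 0 c) :=
    hk.comp hγ.continuousOn fun v hv => hmem v hv
  have hcomp : IsCompact (Icc 0 c ∩ (fun v => k (γ v)) ⁻¹' Iic t) :=
    isCompact_Icc.of_isClosed_subset (hg.preimage_isClosed_of_isClosed isClosed_Icc isClosed_Iic)
      inter_subset_left
  -- The first time at which `k ≤ t`; by continuity the value there is exactly `t`.
  obtain ⟨v₁, ⟨hv₁, hle₁⟩, hleast⟩ := hcomp.exists_isLeast ⟨v₀, hv₀, hle₀⟩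
  have hlt : ∀ v ∈ Ico 0 v₁, t < k (γ v) := fun v hv => by
    by_contra! h
    exact hv.2.not_ge (hleast ⟨⟨hv.1, hv.2.le.trans hv₁.2⟩, h⟩)
  obtain ⟨P, hP, hPc, hPA, hsP⟩ := hA
  have hγ0 : γ 0 = ((G.onEdge e s : G.Point) : G.Completion) := by simp [γ]
  have h0 : t < k (γ 0) := by
    rw [hγ0]
    exact (hP hsP).2
  have hv₁pos : 0 < v₁ := by
    refine hv₁.1.lt_of_ne fun h => ?_
    rw [← h] at hle₁
    exact absurd hle₁ (not_le.2 h0)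
  have hkt : k (γ v₁) = t := by
    obtain ⟨v, hv, hkv⟩ := intermediate_value_Icc' hv₁.1
      (hg.mono (Icc_subset_Icc_right hv₁.2)) ⟨hle₁, h0.le⟩
    have : v = v₁ := le_antisymm hv.2 (hleast ⟨⟨hv.1, hv.2.trans hv₁.2⟩, hkv.le⟩)
    rw [← this]
    exact hkv
  have hs₁ : s + σ * v₁ ∈ Icc 0 (G.len e) := by
    have := hv₁.1
    have := hv₁.2
    rcases hσ with rfl | rfl
    · exact ⟨by linarith [hs.1], by linarith [hsc.2]⟩
    · exact ⟨by linarith [hsc.1], by linarith [hs.2]⟩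
  -- The crossing is not at a vertex, because `t` is not a value at a vertex.
  have hs₁' : s + σ * v₁ ∈ Ioo 0 (G.len e) := by
    refine ⟨hs₁.1.lt_of_ne fun h => htV (G.src e) ?_, hs₁.2.lt_of_ne fun h => htV (G.tgt e) ?_⟩
    · rw [← coe_onEdge_zero, h]
      exact hkt
    · rw [← coe_onEdge_len, ← h]
      exact hkt
  have haway : G.PointsAwayFrom A η k e (s + σ * v₁) σ := by
    refine ⟨P ∪ γ '' Ico 0 v₁, union_subset (fun q hq => ?_) ?_, ?_, hPA.mono ?_, v₁, hv₁pos, ?_⟩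
    · exact ⟨Metric.thickening_mono hρη _ (hP hq).1, (hP hq).2.ne'.trans_eq hkt.symm⟩
    · rintro _ ⟨v, hv, rfl⟩
      exact ⟨Metric.thickening_mono hρη _ (hmem v ⟨hv.1, hv.2.le.trans hv₁.2⟩),
        (hlt v hv).ne'.trans_eq hkt.symm⟩
    · exact hPc.union (γ 0) (hγ0 ▸ hsP) ⟨0, ⟨le_rfl, hv₁pos⟩, rfl⟩
        (isPreconnected_Ico.image _ hγ.continuousOn)
    · exact inter_subset_inter_left _ subset_union_left
    · intro v hv
      refine Or.inr ⟨v₁ - v, ⟨by linarith [hv.2], by linarith [hv.1]⟩, ?_⟩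
      have : s + σ * (v₁ - v) = s + σ * v₁ - σ * v := by ring
      simp only [γ, this]
  have hpos := hout e _ hs₁' hkt (Metric.thickening_mono hρη _ (hmem v₁ hv₁)) σ hσ haway
  -- Otherwise `deriv` takes its default value `0`, which is not positive.
  have hdiff : DifferentiableAt ℝ (G.comp (G.res k) e) (s + σ * v₁) := by
    by_contra h
    rw [deriv_zero_of_not_differentiableAt h, mul_zero] at hpos
    exact hpos.false
  -- Looking backwards from the crossing, `k ≥ t`; hence the derivative in direction `σ` is at most
  -- `0`.
  have hneg := neg_mul_abs_le_mul_deriv (m := -σ) (L := 0) hdiff.hasDerivAt (by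
    filter_upwards [Metric.ball_mem_nhds _ hv₁pos] with r hr hr'
    rw [Metric.mem_ball, Real.dist_eq] at hr
    have h1 : r = s + σ * (v₁ - -σ * (r - (s + σ * v₁))) := by
      rcases hσ with rfl | rfl <;> ring
    have h2 : -σ * (r - (s + σ * v₁)) < v₁ := by
      refine lt_of_le_of_lt ((le_abs_self _).trans_eq ?_) hr
      rw [abs_mul]
      rcases hσ with rfl | rfl <;> simp
    have h3 : t ≤ k (γ (v₁ - -σ * (r - (s + σ * v₁)))) := by
      rcases hr'.eq_or_lt with h | h
      · rw [← h, sub_zero, hkt]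
      · exact (hlt _ ⟨by linarith, by linarith⟩).le
    have h4 : G.comp (G.res k) e r = k (γ (v₁ - -σ * (r - (s + σ * v₁)))) := by
      conv_lhs => rw [h1]
      rfl
    have h5 : G.comp (G.res k) e (s + σ * v₁) = t := hkt
    rw [zero_mul, sub_zero, h4, h5]
    exact h3)
  rw [zero_mul, neg_zero] at hneg
  linarith

/-- The connected set is enlarged by each segment traversed. The ball condition keeps the path in
the region where the level-set hypothesis applies. -/
lemma ConnectedAbove.of_path (hρη : ρ ≤ η) (hk : ContinuousOn k (Metric.thickening ρ A))
    (htV : ∀ v : V, k (G.vertex v) ≠ t)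
    (hout : ∀ e, ∀ s ∈ Ioo 0 (G.len e), G.comp (G.res k) e s = t →
      (⟨e, s⟩ : Coord Edge) ∈ G.coordSet (Metric.thickening η A) →
      ∀ σ : ℝ, σ = 1 ∨ σ = -1 → G.PointsAwayFrom A η k e s σ →
        0 < σ * deriv (G.comp (G.res k) e) s)
    {x y : G.Point} {L : ℝ} (hp : G.Path x y L) (hx : ConnectedAbove A ρ k t x)
    (hball : ∀ q : G.Point, dist q x ≤ L → (q : G.Completion) ∈ Metric.thickening ρ A) :
    ConnectedAbove A ρ k t y := by
  induction hp with
  | refl => exact hx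
  | @tail y z L c hp hs ih =>
    have hy := ih fun q hq => hball q (hq.trans (by linarith [hs.nonneg]))
    have of_zero : G.Step y z 0 → ConnectedAbove A ρ k t z := fun h =>
      coe_eq_coe_of_step h ▸ hy
    cases hs with
    | along e s s' =>
      rw [← onEdge_coe] at hy ⊢
      obtain ⟨σ, hσ, hs'⟩ : ∃ σ : ℝ, (σ = 1 ∨ σ = -1) ∧ (s' : ℝ) = s + σ * |(s' : ℝ) - s| := by
        rcases le_total (s : ℝ) s' with h | h
        · exact ⟨1, Or.inl rfl, by rw [abs_of_nonneg (sub_nonneg.2 h)]; ring⟩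
        · exact ⟨-1, Or.inr rfl, by rw [abs_of_nonpos (sub_nonpos.2 h)]; ring⟩
      have hmem : ∀ v ∈ Icc 0 |(s' : ℝ) - s|,
          ((G.onEdge e (s + σ * v) : G.Point) : G.Completion) ∈ Metric.thickening ρ A := by
        intro v hv
        refine hball _ ?_
        have h1 := dist_le_of_path hp
        have h2 := (lipschitzWith_onEdge (G := G) e).dist_le_mul (s + σ * v) s
        have h3 : |s + σ * v - s| = v := by
          rw [add_sub_cancel_left, abs_mul, abs_of_nonneg hv.1]
          rcases hσ with rfl | rfl <;> simp
        rw [NNReal.coe_one, one_mul, Real.dist_eq, h3] at h2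
        rw [← onEdge_coe, dist_comm] at h1
        have h4 := dist_triangle (G.onEdge e (s + σ * v)) (G.onEdge e s) x
        linarith [hv.2]
      have hlt := hy.lt_along hρη hk htV hout s.2 (hs' ▸ s'.2) hσ hmem
      obtain ⟨P, hP, hPc, hPA, hyP⟩ := hy
      refine ⟨P ∪ (fun v => ((G.onEdge e (s + σ * v) : G.Point) : G.Completion)) ''
        Icc 0 |(s' : ℝ) - s|, union_subset hP ?_, hPc.union _ hyP
          ⟨0, ⟨le_rfl, abs_nonneg _⟩, by simp⟩ (isPreconnected_Icc.image _ ?_),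
          hPA.mono (inter_subset_inter_left _ subset_union_left),
          Or.inr ⟨_, ⟨abs_nonneg _, le_rfl⟩, ?_⟩⟩
      · rintro _ ⟨v, hv, rfl⟩
        exact ⟨hmem v hv, hlt v hv⟩
      · exact ((continuous_coe_onEdge e).comp (by fun_prop)).continuousOn
      · simp only [← hs']
    | leaveSrc e => exact of_zero (Step.leaveSrc e)
    | enterSrc e => exact of_zero (Step.enterSrc e)
    | leaveTgt e => exact of_zero (Step.leaveTgt e)
    | enterTgt e => exact of_zero (Step.enterTgt e)

/-- A function with positive outward derivative on the level sets near `A` is bounded below near `A`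
by its value on `A`. -/
theorem OutwardPositive.exists_le [Countable V] {δ : ℝ} (hδ : 0 < δ)
    (h : G.OutwardPositive A C k) (hk : ContinuousOn k (Metric.thickening δ A))
    (hC : ∀ x ∈ A, k x = C) :
    ∃ ε > 0, ∀ y : G.Point, (y : G.Completion) ∈ Metric.thickening ε A → C ≤ k y := by
  obtain ⟨η, hη, hout⟩ := h
  have hρ : 0 < min η δ := lt_min hη hδ
  -- With `ρ = min η δ`, both `y` and the starting point of the path are within `ρ / 3` of a point
  -- `p` of `A`, so the path can be kept in the ball of radius `ρ` around `p`.
  refine ⟨min η δ / 3, by positivity, fun y hy => ?_⟩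
  generalize hρ' : min η δ = ρ at *
  have hρη : ρ ≤ η := hρ' ▸ min_le_left _ _
  have hk' : ContinuousOn k (Metric.thickening ρ A) :=
    hk.mono (Metric.thickening_mono (hρ' ▸ min_le_right _ _) _)
  by_contra! hlt
  -- Countability of the vertices provides a level strictly between `k y` and `C`, close to `C`,
  -- that is attained at no vertex.
  obtain ⟨t, htV, ht⟩ := ((countable_range fun v : V => k (G.vertex v)).dense_compl ℝ).exists_between
    (max_lt hlt (sub_lt_self C hη))
  have htV' : ∀ v : V, k (G.vertex v) ≠ t := fun v hv => htV ⟨v, hv⟩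
  have hyt : k y < t := (le_max_left _ _).trans_lt ht.1
  have htη : |t - C| < η := by
    rw [abs_lt]
    constructor <;> linarith [(le_max_right _ _).trans_lt ht.1, ht.2]
  obtain ⟨p, hpA, hyp⟩ := Metric.mem_thickening_iff.1 hy
  have hsub : Metric.ball p ρ ⊆ Metric.thickening ρ A := Metric.ball_subset_thickening hpA _
  have hkp : ContinuousAt k p :=
    hk'.continuousAt (Metric.isOpen_thickening.mem_nhds (hsub (Metric.mem_ball_self hρ)))
  have hev : ∀ᶠ q in 𝓝 p, t < k q := hkp.eventually (lt_mem_nhds (by rw [hC p hpA]; exact ht.2))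
  obtain ⟨r, hr, hball⟩ := Metric.eventually_nhds_iff_ball.1 hev
  have hr' : 0 < min r ρ := lt_min hr hρ
  obtain ⟨_, ⟨x, rfl⟩, hx⟩ := Metric.mem_closure_iff.1
    (UniformSpace.Completion.denseRange_coe (α := G.Point) p) (min r ρ / 3) (by positivity)
  rw [dist_comm] at hx
  obtain ⟨S, hS, hSc, hpS, hxS⟩ := exists_isPreconnected_subset_ball hx
  have hxA : ConnectedAbove A ρ k t x := by
    refine ⟨S, fun q hq => ?_, hSc, ⟨p, hpS, hpA⟩, hxS⟩
    have := Metric.mem_ball.1 (hS hq)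
    exact ⟨hsub (Metric.mem_ball.2 (this.trans_le (min_le_right _ _))),
      hball q (Metric.mem_ball.2 (this.trans_le (min_le_left _ _)))⟩
  have hxp : dist (x : G.Completion) p < ρ / 3 :=
    hx.trans_le (by linarith [min_le_right r ρ])
  have hxy : dist x y < 2 * ρ / 3 := by
    rw [← UniformSpace.Completion.dist_eq]
    have := dist_triangle_right (x : G.Completion) y p
    linarith
  obtain ⟨L, hL, hp⟩ := exists_path_lt hxy
  obtain ⟨P, hP, -, -, hyP⟩ := ConnectedAbove.of_path hρη hk' htV' (hout t ht.2.ne htη) hp hxA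
    fun q hq => hsub (by
      rw [Metric.mem_ball]
      have h1 := dist_triangle (q : G.Completion) x p
      rw [UniformSpace.Completion.dist_eq q x] at h1
      linarith)
  exact hyt.not_gt (hP hyP).2

end

/-! ### Partitions of the boundary -/

section Partition

variable {N : ℕ} {E : Fin (N + 1) → Set G.Completion} {δ : ℝ}
  {𝓔 : ℕ → Set (Set G.Completion × Fin (N + 1))}

lemma IsPartitionSequence.finite (h : G.IsPartitionSequence E 𝓔) (j : ℕ) : (𝓔 j).Finite := by
  induction j with
  | zero =>
    rw [h.1]
    exact finite_range _
  | succ j ih =>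
    obtain ⟨parts, hparts, heq⟩ := h.2 j
    rw [heq]
    refine ih.biUnion fun p hp => ?_
    rcases hparts p hp with ⟨A₁, A₂, -, h⟩ | ⟨-, h⟩ <;> rw [h] <;> simp

lemma IsPartitionSequence.subset (h : G.IsPartitionSequence E 𝓔) (j : ℕ) :
    ∀ p ∈ 𝓔 j, p.1 ⊆ E p.2 := by
  induction j with
  | zero =>
    rw [h.1]
    rintro _ ⟨n, rfl⟩
    exact Subset.rfl
  | succ j ih =>
    obtain ⟨parts, hparts, heq⟩ := h.2 j
    intro q hq
    rw [heq] at hq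
    obtain ⟨p, hp, hqp⟩ := mem_iUnion₂.1 hq
    rcases hparts p hp with ⟨A₁, A₂, hs, h⟩ | ⟨-, h⟩
    · have hsub : A₁ ∪ A₂ ⊆ E p.2 := hs.2.2.2.2.2.subset.trans (ih p hp)
      rw [h] at hqp
      rcases hqp with rfl | rfl
      · exact subset_union_left.trans hsub
      · exact subset_union_right.trans hsub
    · rw [h] at hqp
      rw [mem_singleton_iff.1 hqp]
      exact ih p hp

lemma IsPartitionSequence.exists_mem (h : G.IsPartitionSequence E 𝓔) (j : ℕ) {n : Fin (N + 1)}
    {x : G.Completion} (hx : x ∈ E n) : ∃ A, (A, n) ∈ 𝓔 j ∧ x ∈ A := by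
  induction j with
  | zero =>
    rw [h.1]
    exact ⟨E n, ⟨n, rfl⟩, hx⟩
  | succ j ih =>
    obtain ⟨A, hA, hxA⟩ := ih
    obtain ⟨parts, hparts, heq⟩ := h.2 j
    rw [heq]
    rcases hparts _ hA with ⟨A₁, A₂, hs, h⟩ | ⟨-, h⟩
    · have hxA' : x ∈ A₁ ∪ A₂ := hs.2.2.2.2.2.superset hxA
      rcases hxA' with hx | hx
      · exact ⟨A₁, mem_iUnion₂.2 ⟨_, hA, by simp [h]⟩, hx⟩
      · exact ⟨A₂, mem_iUnion₂.2 ⟨_, hA, by simp [h]⟩, hx⟩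
    · exact ⟨A, mem_iUnion₂.2 ⟨_, hA, by simp [h]⟩, hxA⟩

lemma IsPartitionSequence.exists_mem_thickening (h : G.IsPartitionSequence E 𝓔) (j : ℕ)
    {n : Fin (N + 1)} {ε : ℝ} {x : G.Completion} (hx : x ∈ Metric.thickening ε (E n)) :
    ∃ A, (A, n) ∈ 𝓔 j ∧ x ∈ Metric.thickening ε A := by
  obtain ⟨y, hy, hxy⟩ := Metric.mem_thickening_iff.1 hx
  obtain ⟨A, hA, hyA⟩ := h.exists_mem j hy
  exact ⟨A, hA, Metric.mem_thickening_iff.2 ⟨y, hyA, hxy⟩⟩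

lemma IsInitialPartition.thickening_boundary (hE : G.IsInitialPartition E δ) (ε : ℝ) :
    Metric.thickening ε G.boundary = ⋃ n, Metric.thickening ε (E n) := by
  rw [← hE.iUnion_eq, Metric.thickening_iUnion]

/-- The functions assigned to the sets of the initial partition, with the function `0` assigned to
`E 0`. -/
def extendFamily {N : ℕ} (h : Fin N → G.Completion → ℝ) : Fin (N + 1) → G.Completion → ℝ :=
  Fin.cases (fun _ => 0) h

lemma exists_of_mem_domain {P : Set (Set G.Completion × Fin (N + 1))}
    {h : Fin N → G.Completion → ℝ} {φ : G.Point → ℝ} (hφ : φ ∈ G.domain P δ h) :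
    ∃ ε, 0 < ε ∧ ε < δ ∧ ∀ q ∈ P, ∃ c : ℝ, ∀ x : G.Point,
      (x : G.Completion) ∈ Metric.thickening ε q.1 → φ x = c * extendFamily h q.2 x := by
  obtain ⟨-, ε, hε, hεδ, h0, h1⟩ := hφ
  refine ⟨ε, hε, hεδ, ?_⟩
  rintro ⟨A, n⟩ hA
  induction n using Fin.cases with
  | zero => exact ⟨0, fun x hx => by simp [h0 A hA x hx]⟩
  | succ n =>
    obtain ⟨c, hc⟩ := h1 n A hA
    exact ⟨c, fun x hx => hc x hx⟩

lemma sub_mem_domain [Countable Edge] {P : Set (Set G.Completion × Fin (N + 1))}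
    {h : Fin N → G.Completion → ℝ} {φ ψ : G.Point → ℝ} (hφ : φ ∈ G.domain P δ h)
    (hψ : ψ ∈ G.domain P δ h) : φ - ψ ∈ G.domain P δ h := by
  obtain ⟨hφm, ε, hε, hεδ, h0, h1⟩ := hφ
  obtain ⟨hψm, ε', hε', hεδ', h0', h1'⟩ := hψ
  have hl : ∀ A : Set G.Completion, Metric.thickening (min ε ε') A ⊆ Metric.thickening ε A :=
    Metric.thickening_mono (min_le_left _ _)
  have hr : ∀ A : Set G.Completion, Metric.thickening (min ε ε') A ⊆ Metric.thickening ε' A :=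
    Metric.thickening_mono (min_le_right _ _)
  refine ⟨hφm.sub hψm, min ε ε', lt_min hε hε', (min_le_left _ _).trans_lt hεδ,
    fun A hA x hx => ?_, fun n A hA => ?_⟩
  · rw [Pi.sub_apply, h0 A hA x (hl A hx), h0' A hA x (hr A hx), sub_zero]
  · obtain ⟨c, hc⟩ := h1 n A hA
    obtain ⟨c', hc'⟩ := h1' n A hA
    refine ⟨c - c', fun x hx => ?_⟩
    rw [Pi.sub_apply, hc x (hl A hx), hc' x (hr A hx), sub_mul]

lemma eventually_of_forall_mem {S : Set G.Completion} (hS : IsOpen S) {x : G.Point}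
    (hx : (x : G.Completion) ∈ S) : ∀ᶠ y : G.Point in 𝓝 x, (y : G.Completion) ∈ S :=
  (hS.preimage (UniformSpace.Completion.continuous_coe _)).mem_nhds hx

/-- A boundary profile is obtained by gluing profiles near the sets of the initial partition. -/
lemma IsInitialPartition.hasBoundaryProfile (hE : G.IsInitialPartition E δ) {ε : ℝ} (hε : 0 < ε)
    (hεδ : ε ≤ δ) {φ : G.Point → ℝ} {K : Fin (N + 1) → G.Completion → ℝ}
    (hcont : ∀ n, ContinuousOn (K n) (Metric.thickening ε (E n)))
    (hnonneg : ∀ n, ∀ x : G.Point, (x : G.Completion) ∈ Metric.thickening ε (E n) → 0 ≤ K n x)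
    (haff : ∀ n e, ∀ s ∈ Ioo 0 (G.len e),
      (⟨e, s⟩ : Coord Edge) ∈ G.coordSet (Metric.thickening ε (E n)) →
      ∃ m : ℝ, ∀ᶠ r in 𝓝 s, G.comp (G.res (K n)) e r = G.comp (G.res (K n)) e s + m * (r - s))
    (hvan : ∀ n, ∀ x ∈ E n, K n x = 0)
    (hprof : ∀ n, ∀ x : G.Point, (x : G.Completion) ∈ Metric.thickening ε (E n) →
      ∃ c b, 0 ≤ b ∧ ∀ᶠ y in 𝓝 x, φ y = c * (K n y + b)) :
    G.HasBoundaryProfile φ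
      (fun x => ∑ n, (Metric.thickening ε (E n)).indicator (K n) (x : G.Completion))
      (Metric.thickening ε G.boundary) := by
  have hopen : ∀ n, IsOpen (Metric.thickening ε (E n)) := fun n => Metric.isOpen_thickening
  -- The neighborhoods are disjoint, so the sum has at most one nonzero term.
  have hsum : ∀ n, ∀ x ∈ Metric.thickening ε (E n),
      ∑ m, (Metric.thickening ε (E m)).indicator (K m) x = K n x := by
    intro n x hx
    rw [Finset.sum_eq_single n, indicator_of_mem hx]
    · intro m _ hmn
      refine indicator_of_notMem (fun hxm => ?_) _
      exact disjoint_left.1 (hE.thickening_disjoint hmn)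
        (Metric.thickening_mono hεδ _ hxm) (Metric.thickening_mono hεδ _ hx)
    · simp
  have hev : ∀ n, ∀ x : G.Point, (x : G.Completion) ∈ Metric.thickening ε (E n) →
      ∀ᶠ y : G.Point in 𝓝 x,
        ∑ m, (Metric.thickening ε (E m)).indicator (K m) (y : G.Completion) = K n y :=
    fun n x hx => (eventually_of_forall_mem (hopen n) hx).mono fun y hy => hsum n y hy
  have hU := hE.thickening_boundary ε
  refine ⟨fun x => ?_, fun x hx => ?_, fun e s hs hx => ?_, fun t ht => ?_, fun x hx => ?_⟩
  · refine Finset.sum_nonneg fun n _ => ?_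
    by_cases hx : (x : G.Completion) ∈ Metric.thickening ε (E n)
    · rw [indicator_of_mem hx]
      exact hnonneg n x hx
    · rw [indicator_of_notMem hx]
  · rw [hU] at hx
    obtain ⟨n, hn⟩ := mem_iUnion.1 hx
    have h1 : ContinuousAt (fun y : G.Point => K n y) x :=
      ContinuousAt.comp (f := fun y : G.Point => (y : G.Completion))
        ((hcont n).continuousAt ((hopen n).mem_nhds hn))
        (UniformSpace.Completion.continuous_coe _).continuousAt
    exact h1.congr ((hev n x hn).mono fun y hy => hy.symm)
  · rw [hU] at hx
    obtain ⟨n, hn⟩ := mem_iUnion.1 hx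
    obtain ⟨m, hm⟩ := haff n e s hs hn
    have h1 := (continuous_onEdge e).tendsto s |>.eventually (hev n _ hn)
    refine ⟨m, ?_⟩
    filter_upwards [h1, hm] with r hr hmr
    simp only [comp, res] at hr hmr ⊢
    rw [hr, h1.self_of_nhds, hmr]
  · refine ⟨⋃ n, Metric.thickening ε (E n) ∩ K n ⁻¹' Iio t,
      isOpen_iUnion fun n => (hcont n).isOpen_inter_preimage (hopen n) isOpen_Iio, ?_, ?_⟩
    · rw [← hE.iUnion_eq]
      refine iUnion_mono fun n x hx => ⟨Metric.self_subset_thickening hε _ hx, ?_⟩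
      rw [mem_preimage, hvan n x hx]
      exact ht
    · intro x hx
      obtain ⟨n, hn, hlt⟩ := mem_iUnion.1 hx
      rw [hsum n x hn]
      exact hlt
  · rw [hU] at hx
    obtain ⟨n, hn⟩ := mem_iUnion.1 hx
    obtain ⟨c, b, hb, hφ⟩ := hprof n x hn
    refine ⟨c, b, hb, ?_⟩
    filter_upwards [hφ, hev n x hn] with y h1 h2
    rw [h1, h2]

end Partition

/-! ### The energy of the functions in the domain -/

lemma MemDmax.memLp_indicator_edges [Countable Edge] {φ : G.Point → ℝ} (hφ : G.MemDmax φ)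
    {S : Set Edge} (hS : S.Finite) :
    MemLp ({p : Coord Edge | p.1 ∈ S}.indicator (G.deriv₁ φ)) 2 G.vol := by
  have hmeas : MeasurableSet {p : Coord Edge | p.1 ∈ S} :=
    measurableSet_sigma_iff.2 fun e => by
      by_cases h : e ∈ S <;> simp [h]
  refine (memLp_two_iff_integrable_sq (hφ.aestronglyMeasurable_deriv₁.indicator hmeas)).2 ?_
  refine integrable_of_finite_edges (S := hS.toFinset) (fun e he => ae_of_all _ fun s => ?_)
    fun e he => ?_
  · rw [Finite.mem_toFinset] at he
    rw [indicator_of_notMem (by exact he)]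
    simp
  · rw [Finite.mem_toFinset] at he
    have h1 : (fun s => {p : Coord Edge | p.1 ∈ S}.indicator (G.deriv₁ φ) ⟨e, s⟩ ^ 2) =
        fun s => G.compDeriv φ e s ^ 2 := funext fun s => by
      rw [indicator_of_mem (by exact he)]
      rfl
    rw [h1]
    exact ((hφ.continuousOn_compDeriv e).pow 2).integrableOn_Icc

section Domain

variable {N : ℕ} {E : Fin (N + 1) → Set G.Completion} {δ : ℝ}
  {𝓔 : ℕ → Set (Set G.Completion × Fin (N + 1))}

/-- Near the boundary `φ'` is a multiple of one of finitely many derivatives of finite energy; the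
rest of the graph lies on finitely many edges, on each of which `φ'` is continuous. -/
lemma memLp_deriv₁_of_mem_domain [Countable Edge] [CompactSpace G.Completion]
    (hE : G.IsInitialPartition E δ) (h𝓔 : G.IsPartitionSequence E 𝓔) {j : ℕ}
    {k : Fin N → G.Completion → ℝ}
    (hk : ∀ n : Fin N, G.FiniteEnergyOn (k n) (Metric.thickening δ (E n.succ)))
    {φ : G.Point → ℝ} (hφ : φ ∈ G.domain (𝓔 j) δ k) : MemLp (G.deriv₁ φ) 2 G.vol := by
  obtain ⟨ε, hε, hεδ, hc⟩ := exists_of_mem_domain hφ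
  choose! c hc using hc
  have hφm := hφ.1
  have hfin := finite_edges_of_boundary_subset (G := G)
    (O := Metric.thickening ε G.boundary) Metric.isOpen_thickening
    (Metric.self_subset_thickening hε _)
  set S : Set Edge :=
    {e | ∃ s, ((G.onEdge e s : G.Point) : G.Completion) ∉ Metric.thickening ε G.boundary}
  let F : Set G.Completion × Fin (N + 1) → Coord Edge → ℝ := fun q =>
    (G.coordSet (Metric.thickening ε q.1)).indicator
      (c q • G.deriv₁ (G.res (extendFamily k q.2)))
  have hF : ∀ q ∈ (h𝓔.finite j).toFinset, MemLp (fun p => ‖F q p‖) 2 G.vol := by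
    intro q hq
    rw [Finite.mem_toFinset] at hq
    refine MemLp.norm ((memLp_indicator_iff_restrict
      (measurableSet_coordSet Metric.isOpen_thickening)).2 (MemLp.const_smul ?_ _))
    have hen : G.FiniteEnergyOn (extendFamily k q.2) (Metric.thickening δ (E q.2)) := by
      obtain ⟨A, n⟩ := q
      induction n using Fin.cases with
      | zero =>
        have h0 : G.deriv₁ (G.res (extendFamily k 0)) = 0 := by
          ext p
          have h : G.comp (G.res (extendFamily k 0)) p.1 = fun _ => 0 := rfl
          simp [deriv₁, compDeriv, h]
        rw [FiniteEnergyOn, h0]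
        exact MemLp.zero
      | succ n => exact hk n
    refine hen.mono_measure (Measure.restrict_mono ?_ le_rfl)
    intro p hp
    exact Metric.thickening_mono hεδ.le _ (Metric.thickening_subset_of_subset ε (h𝓔.subset j q hq) hp)
  refine MemLp.mono' (g := fun p => ∑ q ∈ (h𝓔.finite j).toFinset, ‖F q p‖ +
      ‖{p : Coord Edge | p.1 ∈ S}.indicator (G.deriv₁ φ) p‖)
    ((memLp_finsetSum _ hF).add (hφm.memLp_indicator_edges hfin).norm)
    hφm.aestronglyMeasurable_deriv₁ (ae_vol_of_Ioo fun e => ae_of_all _ fun s hs => ?_)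
  have hnn : 0 ≤ ∑ q ∈ (h𝓔.finite j).toFinset, ‖F q ⟨e, s⟩‖ :=
    Finset.sum_nonneg fun q _ => norm_nonneg _
  by_cases hx : ((G.onEdge e s : G.Point) : G.Completion) ∈ Metric.thickening ε G.boundary
  · rw [hE.thickening_boundary] at hx
    obtain ⟨n, hn⟩ := mem_iUnion.1 hx
    obtain ⟨A, hA, hxA⟩ := h𝓔.exists_mem_thickening j hn
    have h1 : G.comp φ e =ᶠ[𝓝 s] fun r => c (A, n) * G.comp (G.res (extendFamily k n)) e r :=
      ((continuous_onEdge e).tendsto s |>.eventually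
        (eventually_of_forall_mem Metric.isOpen_thickening hxA)).mono
        fun r hr => hc (A, n) hA _ hr
    have h2 : G.deriv₁ φ ⟨e, s⟩ = F (A, n) ⟨e, s⟩ := by
      simp only [F]
      rw [indicator_of_mem (by exact hxA), Pi.smul_apply, smul_eq_mul, deriv₁, deriv₁,
        compDeriv_eq_deriv hs, compDeriv_eq_deriv hs, h1.deriv_eq, deriv_const_mul_field]
    have h3 := Finset.single_le_sum (f := fun q => ‖F q ⟨e, s⟩‖) (fun q _ => norm_nonneg _)
      ((h𝓔.finite j).mem_toFinset.2 hA)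
    rw [h2]
    have h4 := norm_nonneg ({p : Coord Edge | p.1 ∈ S}.indicator (G.deriv₁ φ) ⟨e, s⟩)
    linarith
  · rw [indicator_of_mem (show (⟨e, s⟩ : Coord Edge) ∈ {p : Coord Edge | p.1 ∈ S} from ⟨s, hx⟩)]
    linarith

/-- The energy estimate for harmonic boundary profiles. -/
theorem IsPositiveFamily.integral_sq_le_form [Countable V] [Countable Edge]
    [CompactSpace G.Completion] (hE : G.IsInitialPartition E δ) (h𝓔 : G.IsPartitionSequence E 𝓔)
    {j : ℕ} {C : Fin N → ℝ} {k : Fin N → G.Completion → ℝ} (hk : G.IsPositiveFamily E δ C k)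
    {φ : G.Point → ℝ} (hφ : φ ∈ G.domain (𝓔 j) δ k) :
    ∫ p, G.deriv₁ φ p ^ 2 ∂G.vol ≤ G.form φ φ := by
  obtain ⟨ε₁, hε₁, hε₁δ, hc⟩ := exists_of_mem_domain hφ
  have hlow := fun n => (hk.outwardPositive n).exists_le hE.pos (hk.harmonic n).continuousOn
    (hk.eq_const n)
  choose ρ hρ hlow using hlow
  obtain ⟨ε, hε, hεε₁, hερ⟩ : ∃ ε > 0, ε ≤ ε₁ ∧ ∀ n, ε ≤ ρ n := by
    have h : ∀ᶠ ε : ℝ in 𝓝[>] 0, ε ≤ ε₁ ∧ ∀ n, ε ≤ ρ n :=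
      Eventually.and (nhdsWithin_le_nhds (eventually_le_nhds hε₁))
        (eventually_all.2 fun n => nhdsWithin_le_nhds (eventually_le_nhds (hρ n)))
    obtain ⟨ε, h, hε⟩ := (h.and self_mem_nhdsWithin).exists
    exact ⟨ε, hε, h⟩
  have hεδ : ε ≤ δ := hεε₁.trans hε₁δ.le
  have hprofile := hE.hasBoundaryProfile hε hεδ (φ := φ)
    (K := extendFamily fun n x => k n x - C n) ?_ ?_ ?_ ?_ ?_
  · obtain ⟨θ, L, hθ⟩ := exists_isBoundaryBump (G := G) hε
    exact hprofile.integral_sq_le_form Metric.isOpen_thickening hθ hφ.1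
      (memLp_deriv₁_of_mem_domain hE h𝓔 hk.finiteEnergy hφ)
  · intro n
    induction n using Fin.cases with
    | zero => exact continuousOn_const
    | succ n =>
      exact ((hk.harmonic n).continuousOn.mono (Metric.thickening_mono hεδ _)).sub
        continuousOn_const
  · intro n x hx
    induction n using Fin.cases with
    | zero => exact le_rfl
    | succ n => exact sub_nonneg.2 (hlow n x (Metric.thickening_mono (hερ n) _ hx))
  · intro n e s hs hx
    induction n using Fin.cases with
    | zero => exact ⟨0, Eventually.of_forall fun r => by simp [comp, res, extendFamily]⟩
    | succ n =>
      obtain ⟨m, hm⟩ := (hk.harmonic n).locally_affine e s hs (Metric.thickening_mono hεδ _ hx)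
      refine ⟨m, hm.mono fun r hr => ?_⟩
      simp only [comp, res, extendFamily, Fin.cases_succ] at hr ⊢
      linarith
  · intro n x hx
    induction n using Fin.cases with
    | zero => rfl
    | succ n => exact sub_eq_zero.2 (hk.eq_const n x hx)
  · intro n x hx
    obtain ⟨A, hA, hxA⟩ := h𝓔.exists_mem_thickening j (Metric.thickening_mono hεε₁ _ hx)
    obtain ⟨c, hc⟩ := hc _ hA
    have hev := (eventually_of_forall_mem Metric.isOpen_thickening hxA).mono fun y hy => hc y hy
    induction n using Fin.cases with
    | zero => exact ⟨c, 0, le_rfl, hev.mono fun y hy => by simpa [extendFamily] using hy⟩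
    | succ n =>
      -- Here `c * k = c * ((k - C) + C)`: the shift `b` is the positive boundary value.
      refine ⟨c, C n, (hk.pos n).le, hev.mono fun y hy => ?_⟩
      simpa [extendFamily] using hy

/-- For boundary profiles which are constant, the energy is the form of `-D²`. -/
theorem form_eq_integral_sq_of_const [Countable Edge] [CompactSpace G.Completion]
    (hE : G.IsInitialPartition E δ) (h𝓔 : G.IsPartitionSequence E 𝓔) {j : ℕ} {a : Fin N → ℝ}
    {h : Fin N → G.Completion → ℝ}
    (ha : ∀ n : Fin N, ∀ x ∈ Metric.thickening δ (E n.succ), h n x = a n)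
    {φ : G.Point → ℝ} (hφ : φ ∈ G.domain (𝓔 j) δ h) :
    MemLp (G.deriv₁ φ) 2 G.vol ∧ G.form φ φ = ∫ p, G.deriv₁ φ p ^ 2 ∂G.vol := by
  obtain ⟨ε, hε, hεδ, hc⟩ := exists_of_mem_domain hφ
  obtain ⟨θ, L, hθ⟩ := exists_isBoundaryBump (G := G) hε
  refine HasBoundaryProfile.form_eq_integral_sq ?_ Metric.isOpen_thickening hθ hφ.1
  -- With `κ = 0` the whole profile is carried by the constants `c` and `b`.
  refine ⟨fun _ => le_rfl, fun _ _ => continuousAt_const,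
    fun e s _ _ => ⟨0, Eventually.of_forall fun r => by simp [comp]⟩,
    fun t ht => ⟨univ, isOpen_univ, subset_univ _, fun _ _ => ht⟩, fun x hx => ?_⟩
  rw [hE.thickening_boundary] at hx
  obtain ⟨n, hn⟩ := mem_iUnion.1 hx
  obtain ⟨A, hA, hxA⟩ := h𝓔.exists_mem_thickening j hn
  obtain ⟨c, hc⟩ := hc _ hA
  have hev := eventually_of_forall_mem Metric.isOpen_thickening hxA
  induction n using Fin.cases with
  | zero =>
    refine ⟨0, 0, le_rfl, hev.mono fun y hy => ?_⟩
    rw [hc y hy]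
    simp [extendFamily]
  | succ n =>
    refine ⟨c * a n, 1, zero_le_one, ?_⟩
    filter_upwards [hev] with y hy
    have h1 : extendFamily h n.succ y = a n := ha n y (Metric.thickening_mono hεδ.le _
      (Metric.thickening_subset_of_subset ε (h𝓔.subset j _ hA) hy))
    rw [hc y hy, h1, zero_add, mul_one]

end Domain

/-! ### The closure of the form -/

lemma sq_toReal_eLpNorm_two {α : Type*} {m : MeasurableSpace α} {μ : Measure α} {g : α → ℝ}
    (hg : MemLp g 2 μ) : (eLpNorm g 2 μ).toReal ^ 2 = ∫ x, g x ^ 2 ∂μ := by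
  have h0 : 0 ≤ ∫ x, g x ^ 2 ∂μ := integral_nonneg fun x => sq_nonneg _
  rw [hg.eLpNorm_eq_integral_rpow_norm (by norm_num) (by norm_num)]
  simp only [ENNReal.toReal_ofNat, Real.rpow_ofNat, Real.norm_eq_abs, sq_abs]
  rw [ENNReal.toReal_ofReal (by positivity), ← Real.rpow_natCast, ← Real.rpow_mul h0]
  norm_num

/-- If the form of `-D²` bounds the energy on `D`, then the limits of form-Cauchy sequences in `D`
are represented by regular functions. -/
theorem FormConverges.exists_isRegularRepresentative [Countable Edge] [CompactSpace G.Completion]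
    {D : Set (G.Point → ℝ)} (hD : ∀ f ∈ D, G.MemDmax f)
    (hsub : ∀ f ∈ D, ∀ g ∈ D, f - g ∈ D) (hL : ∀ f ∈ D, MemLp (G.deriv₁ f) 2 G.vol)
    (hform : ∀ f ∈ D, ∫ p, G.deriv₁ f p ^ 2 ∂G.vol ≤ G.form f f)
    {u : ℕ → G.Point → ℝ} {f : G.L2} (h : G.FormConverges D u f) :
    ∃ F, G.IsRegularRepresentative f F ∧
      Tendsto (fun n => eLpNorm (G.deriv₁ (u n) - G.deriv₁ (G.res F)) 2 G.vol) atTop (𝓝 0) := by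
  have hd : ∀ p : ℕ × ℕ, u p.1 - u p.2 ∈ D := fun p => hsub _ (h.mem _) _ (h.mem _)
  refine MetricGraph.exists_isRegularRepresentative (fun n => hD _ (h.mem n))
    (fun n => hL _ (h.mem n)) ?_ h.tendsto
  -- The energy inequality is applied to differences; the `L²` part of `⟨·,·⟩_F` is nonnegative and
  -- can be dropped.
  have h1 : Tendsto (fun p : ℕ × ℕ => (eLpNorm (G.deriv₁ (u p.1 - u p.2)) 2 G.vol).toReal ^ 2)
      atTop (𝓝 0) := by
    refine squeeze_zero (fun p => sq_nonneg _) (fun p => ?_) h.cauchy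
    rw [sq_toReal_eLpNorm_two (hL _ (hd p))]
    refine (hform _ (hd p)).trans (le_add_of_nonneg_right ?_)
    exact integral_nonneg fun x => mul_self_nonneg _
  have h2 := (Real.continuous_sqrt.tendsto 0).comp h1
  simp only [Function.comp_def, Real.sqrt_sq ENNReal.toReal_nonneg, Real.sqrt_zero] at h2
  have h3 := ENNReal.tendsto_ofReal h2
  simp only [ENNReal.ofReal_zero] at h3
  exact h3.congr fun p => ENNReal.ofReal_toReal (hL _ (hd p)).2.ne

lemma tendsto_integral_sq_of_tendsto_eLpNorm {α : Type*} {m : MeasurableSpace α} {μ : Measure α}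
    {g : ℕ → α → ℝ} {g₀ : α → ℝ} (hg : ∀ n, MemLp (g n) 2 μ) (hg₀ : MemLp g₀ 2 μ)
    (h : Tendsto (fun n => eLpNorm (g n - g₀) 2 μ) atTop (𝓝 0)) :
    Tendsto (fun n => ∫ x, g n x ^ 2 ∂μ) atTop (𝓝 (∫ x, g₀ x ^ 2 ∂μ)) := by
  have h1 := ((Lp.tendsto_Lp_iff_tendsto_eLpNorm'' g hg g₀ hg₀).2 h).norm.pow 2
  simp only [Lp.norm_toLp, sq_toReal_eLpNorm_two hg₀] at h1
  exact h1.congr fun n => sq_toReal_eLpNorm_two (hg n)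

end MetricGraph

end

theorem corollary4p4 {V Edge : Type*} [Countable V] [Countable Edge] (G : MetricGraph V Edge)
    (hcompact : CompactSpace G.Completion) (hbdry : IsTotallyDisconnected G.boundary)
    {N : ℕ} (E : Fin (N + 1) → Set G.Completion) (δ : ℝ) (hE : G.IsInitialPartition E δ)
    (𝓔 : ℕ → Set (Set G.Completion × Fin (N + 1))) (h𝓔 : G.IsPartitionSequence E 𝓔) (j : ℕ) :
    (∀ (C : Fin N → ℝ) (k : Fin N → G.Completion → ℝ), G.IsPositiveFamily E δ C k →
      ∀ f ∈ G.formCompletion (G.domain (𝓔 j) δ k), ∃ F, G.IsRegularRepresentative f F) ∧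
    (∀ (a : Fin N → ℝ) (h : Fin N → G.Completion → ℝ),
      (∀ n, ∀ x ∈ Metric.thickening δ (E n.succ), h n x = a n) →
      ∀ f ∈ G.formCompletion (G.domain (𝓔 j) δ h),
        ∃ F, G.IsRegularRepresentative f F ∧
          ∀ r : ℝ, G.IsClosedFormValue (G.domain (𝓔 j) δ h) f r ↔
            r = ∫ p, G.deriv₁ (G.res F) p ^ 2 ∂G.vol) := by
  refine ⟨fun C k hk f ⟨u, hu⟩ => ?_, fun a h ha f ⟨u, hu⟩ => ?_⟩
  · obtain ⟨F, hF, -⟩ := hu.exists_isRegularRepresentative (fun f hf => hf.1)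
      (fun f hf g hg => MetricGraph.sub_mem_domain hf hg)
      (fun f hf => MetricGraph.memLp_deriv₁_of_mem_domain hE h𝓔 hk.finiteEnergy hf)
      (fun f hf => hk.integral_sq_le_form hE h𝓔 hf)
    exact ⟨F, hF⟩
  · have key := fun φ hφ => MetricGraph.form_eq_integral_sq_of_const (φ := φ) (j := j) hE h𝓔 ha hφ
    have hlim : ∀ v, G.FormConverges (G.domain (𝓔 j) δ h) v f → ∃ F,
        G.IsRegularRepresentative f F ∧ Tendsto (fun n => G.form (v n) (v n)) atTop
          (𝓝 (∫ p, G.deriv₁ (G.res F) p ^ 2 ∂G.vol)) := by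
      intro v hv
      obtain ⟨F, hF, ht⟩ := hv.exists_isRegularRepresentative (fun f hf => hf.1)
        (fun f hf g hg => MetricGraph.sub_mem_domain hf hg) (fun f hf => (key f hf).1)
        (fun f hf => (key f hf).2.ge)
      refine ⟨F, hF, ?_⟩
      exact (MetricGraph.tendsto_integral_sq_of_tendsto_eLpNorm (fun n => (key _ (hv.mem n)).1)
        hF.memLp_deriv ht).congr fun n => ((key _ (hv.mem n)).2).symm
    obtain ⟨F, hF, ht⟩ := hlim u hu
    refine ⟨F, hF, fun r => ⟨?_, fun hr => ⟨u, hu, hr ▸ ht⟩⟩⟩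
    rintro ⟨v, hv, hr⟩
    obtain ⟨F', hF', ht'⟩ := hlim v hv
    -- Another admissible sequence may produce another representative, but its derivative is the
    -- same, so the limit does not depend on the sequence.
    rw [hF.deriv₁_eq hF']
    exact tendsto_nhds_unique hr ht'
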